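/- Let $n\ge 2$, $\alpha>0$, $1\le p\le\infty$, $1/p+1/p'=1$ (with $1/\infty=0$), and $\mu,\nu\in\mathbb R$. Let $S^n$ be the unit sphere in $\mathbb R^{n+1}$ with surface area measure $dx$, and $\sigma_{n-1}=2\pi^{n/2}/\Gamma(n/2)$. For $\varphi:S^n\to\mathbb C$ put $$(S^\alpha_+\varphi)(x)=\frac{2}{\Gamma(\alpha)\,\sigma_{n-1}}\int_{\{y\in S^n:\,-1<y_{n+1}<x_{n+1}\}}\frac{(x_{n+1}-y_{n+1})^\alpha}{|x-y|^n}\,\varphi(y)\,dy,$$ $$(S^\alpha_-\varphi)(x)=\frac{2}{\Gamma(\alpha)\,\sigma_{n-1}}\int_{\{y\in S^n:\,x_{n+1}<y_{n+1}<1\}}\frac{(y_{n+1}-x_{n+1})^\alpha}{|x-y|^n}\,\varphi(y)\,dy.$$ For a weight $w$ let $L^p(S^n;w)$ be the space of $f:S^n\to\mathbb C$ with $\|f\|_{L^p(S^n;w)}=\|wf\|_{L^p(S^n)}<\infty$. Let $w(x)=(1+x_{n+1})^\mu(1-x_{n+1})^\nu$ and let $\varepsilon>0$ be arbitrary. (i)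 If $\mu<n/(2p')$, then $S^\alpha_+$ is bounded from $L^p(S^n;w)$ to $L^p(S^n;w_+)$, where $w_+(x)=(1+x_{n+1})^{\mu_+}(1-x_{n+1})^{\nu_+}$, $\mu_+=\mu-\alpha$, and $\nu_+=\nu-\alpha$ if $\nu-\alpha>-n/(2p)$, $\nu_+=-n/(2p)+\varepsilon$ if $\nu-\alpha\le -n/(2p)$. (ii) If $\nu<n/(2p')$, then $S^\alpha_-$ is bounded from $L^p(S^n;w)$ to $L^p(S^n;w_-)$, where $w_-(x)=(1+x_{n+1})^{\mu_-}(1-x_{n+1})^{\nu_-}$, $\nu_-=\nu-\alpha$, and $\mu_-=\mu-\alpha$ if $\mu-\alpha>-n/(2p)$, $\mu_-=-n/(2p)+\varepsilon$ if $\mu-\alpha\le -n/(2p)$. Here boundedness means that for every $\varphi\in L^p(S^n;w)$ the integral defining $S^\alpha_\pm\varphi$ converges absolutely for almost all $x$, and $\|S^\alpha_\pm\varphi\|_{L^p(S^n;w_\pm)}\le C\,\|\varphi\|_{L^p(S^n;w)}$ with $C$ independent of $\varphi$. -/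

import Mathlib

open MeasureTheory
open scoped ENNReal NNReal

noncomputable section

namespace SphericalFrac

/-- The unit sphere `S^n` in the Euclidean space `ℝ^{n+1}`. -/
abbrev Sph (n : ℕ) : Type :=
  Metric.sphere (0 : EuclideanSpace ℝ (Fin (n + 1))) 1

/-- The standard surface area measure on `S^n`. -/
def surf (n : ℕ) : Measure (Sph n) :=
  (volume : Measure (EuclideanSpace ℝ (Fin (n + 1)))).toSphere

/-- The last coordinate `x_{n+1}` of a point of `S^n`. -/
def lastCoord {n : ℕ} (x : Sph n) : ℝ :=
  (x : EuclideanSpace ℝ (Fin (n + 1))) (Fin.last n)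

/-- The spherical segment `{y ∈ S^n : a < y_{n+1} < b}`. -/
def segment (n : ℕ) (a b : ℝ) : Set (Sph n) :=
  {y | a < lastCoord y ∧ lastCoord y < b}

/-- The area `2 π^{n/2} / Γ(n/2)` of the unit sphere `S^{n-1}` in `ℝ^n`. -/
def sphereArea (n : ℕ) : ℝ :=
  2 * Real.pi ^ ((n : ℝ) / 2) / Real.Gamma ((n : ℝ) / 2)

/-- The integrand `(x_{n+1} - y_{n+1})^α |x - y|^{-n} φ(y)` of the left-sided integral. -/
def leftIntegrand {n : ℕ} (α : ℝ) (φ : Sph n → ℂ) (x y : Sph n) : ℂ :=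
  (((lastCoord x - lastCoord y) ^ α /
    ‖(x : EuclideanSpace ℝ (Fin (n + 1))) - y‖ ^ n : ℝ) : ℂ) * φ y

/-- The integrand `(y_{n+1} - x_{n+1})^α |x - y|^{-n} φ(y)` of the right-sided integral. -/
def rightIntegrand {n : ℕ} (α : ℝ) (φ : Sph n → ℂ) (x y : Sph n) : ℂ :=
  (((lastCoord y - lastCoord x) ^ α /
    ‖(x : EuclideanSpace ℝ (Fin (n + 1))) - y‖ ^ n : ℝ) : ℂ) * φ y

/-- The left-sided spherical fractional integral `S^α_{a+} φ`. -/
def leftFrac {n : ℕ} (α a : ℝ) (φ : Sph n → ℂ) (x : Sph n) : ℂ :=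
  ((2 / (Real.Gamma α * sphereArea n) : ℝ) : ℂ) *
    ∫ y in segment n a (lastCoord x), leftIntegrand α φ x y ∂(surf n)

/-- The right-sided spherical fractional integral `S^α_{b-} φ`. -/
def rightFrac {n : ℕ} (α b : ℝ) (φ : Sph n → ℂ) (x : Sph n) : ℂ :=
  ((2 / (Real.Gamma α * sphereArea n) : ℝ) : ℂ) *
    ∫ y in segment n (lastCoord x) b, rightIntegrand α φ x y ∂(surf n)

/-- The integral defining `(S^α_{a+} φ)(x)` exists in the Lebesgue sense. -/
def LeftFracExists {n : ℕ} (α a : ℝ) (φ : Sph n → ℂ) (x : Sph n) : Prop :=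
  IntegrableOn (leftIntegrand α φ x) (segment n a (lastCoord x)) (surf n)

/-- The integral defining `(S^α_{b-} φ)(x)` exists in the Lebesgue sense. -/
def RightFracExists {n : ℕ} (α b : ℝ) (φ : Sph n → ℂ) (x : Sph n) : Prop :=
  IntegrableOn (rightIntegrand α φ x) (segment n (lastCoord x) b) (surf n)

/-- `S^α_+ = S^α_{(-1)+}`. -/
def SPlus {n : ℕ} (α : ℝ) (φ : Sph n → ℂ) : Sph n → ℂ := leftFrac α (-1) φ

/-- `S^α_- = S^α_{1-}`. -/
def SMinus {n : ℕ} (α : ℝ) (φ : Sph n → ℂ) : Sph n → ℂ := rightFrac α 1 φ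

/-- The weight `(1 + x_{n+1})^μ (1 - x_{n+1})^ν`. -/
def weight (n : ℕ) (μ ν : ℝ) (x : Sph n) : ℝ :=
  (1 + lastCoord x) ^ μ * (1 - lastCoord x) ^ ν

/-- `‖f‖_{L^p(S^n; w)} = ‖w f‖_{L^p(S^n)}`. -/
def wNorm {n : ℕ} (p : ℝ≥0∞) (w : Sph n → ℝ) (f : Sph n → ℂ) : ℝ≥0∞ :=
  eLpNorm (fun x => (w x : ℂ) * f x) p (surf n)

/-- `f ∈ L^p(S^n; w)`. -/
def MemWLp {n : ℕ} (p : ℝ≥0∞) (w : Sph n → ℝ) (f : Sph n → ℂ) : Prop :=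
  MemLp (fun x => (w x : ℂ) * f x) p (surf n)

/-- Boundedness from `L^p(S^n; w)` to `L^p(S^n; v)` of an operator `T` given by an integral
formula, where `E φ x` says that the integral defining `T φ` at `x` exists: for every
`φ ∈ L^p(S^n; w)` the function `T φ` is defined almost everywhere and belongs to `L^p(S^n; v)`,
and its norm is at most a constant (independent of `φ`) times the norm of `φ`. -/
def IsBoundedOp {n : ℕ} (T : (Sph n → ℂ) → Sph n → ℂ) (E : (Sph n → ℂ) → Sph n → Prop)
    (p : ℝ≥0∞) (w v : Sph n → ℝ) : Prop :=
  ∃ C : ℝ≥0, ∀ φ : Sph n → ℂ, MemWLp p w φ →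
    (∀ᵐ x ∂(surf n), E φ x) ∧ MemWLp p v (T φ) ∧ wNorm p v (T φ) ≤ C * wNorm p w φ

/-- The exponent that equals `c - α` if `c - α > -n/(2p)`, and `-n/(2p) + ε` otherwise
(with `1/p = 0` for `p = ∞`). -/
def shiftedExp (n : ℕ) (p : ℝ≥0∞) (α c ε : ℝ) : ℝ :=
  if c - α > -((n : ℝ) / 2 * (1 / p).toReal) then c - α
  else -((n : ℝ) / 2 * (1 / p).toReal) + ε

end SphericalFrac

end

open MeasureTheory
open scoped ENNReal NNReal

namespace SphericalFrac

open Set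

/-! The operators are positive integral operators whose kernel depends on the last coordinates and
on the distance only, and the weights are zonal, so everything reduces to one variable. Write n = k
+ 2, t and s for the last coordinates of x and y, and ξ, η for their directions in S^{n-1}. Then |x
- y|² = A - B ξ·η with A = 2(1 - ts), B = 2√(1 - t²)√(1 - s²), and A² - B² = 4(t - s)². The average
over η of (A - B ξ·η)^{-n/2} is a Poisson integral, bounded by a multiple of A^{-k/2}/(t - s)
(`exists_lintegral_inner_rpow_le`). Since A ≥ (1 + t)(1 - s), what remains is dominated by the
Riemann–Liouville kernel (t - s)^{α-1} times ((1 + s)/(1 + t))^{k/2}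
(`exists_lintegral_leftKernel_mul_le`).

Consequently the kernel maps the power weight with exponents (a, b) into a multiple of the one with
exponents (a + α, b + α), provided a > -n/2 and b < -α. The reflection in the equator transposes the
kernel, so the transposed operator does the same when a < -α and b > -n/2. For 1 < p < ∞ these are
the two halves of Schur's test with a power weight; the admissible exponents of the test weight form
nonempty intervals exactly when μ < n/(2p') and ν - α > -n/(2p). The cases p = 1 and p = ∞ need only
one half (`exists_eLpNorm_lintegral_leftKernel_le`).

If ν - α ≤ -n/(2p), then ν is first raised to -n/(2p) + ε + α, which only weakens the norm on the
domain. The reflection carries the result from S^α_+ to S^α_-. -/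

/-! ### Slice integration on the sphere. -/

/-- The point `(x, z)` of `ℝ^{n+1}` for `x ∈ ℝ^n` and `z ∈ ℝ`. -/
noncomputable def joinLast {n : ℕ} (x : EuclideanSpace ℝ (Fin n)) (z : ℝ) :
    EuclideanSpace ℝ (Fin (n + 1)) :=
  WithLp.toLp 2 (Fin.insertNth (Fin.last n) z (WithLp.ofLp x))

lemma joinLast_last {n : ℕ} (x : EuclideanSpace ℝ (Fin n)) (z : ℝ) :
    joinLast x z (Fin.last n) = z := by
  simp [joinLast]

lemma joinLast_castSucc {n : ℕ} (x : EuclideanSpace ℝ (Fin n)) (z : ℝ) (i : Fin n) :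
    joinLast x z i.castSucc = x i := by
  simp [joinLast]

lemma inner_joinLast {n : ℕ} (x y : EuclideanSpace ℝ (Fin n)) (z w : ℝ) :
    inner ℝ (joinLast x z) (joinLast y w) = inner ℝ x y + z * w := by
  simp only [PiLp.inner_apply, Fin.sum_univ_castSucc, joinLast_last, joinLast_castSucc]
  simp [mul_comm]

lemma norm_joinLast_sq {n : ℕ} (x : EuclideanSpace ℝ (Fin n)) (z : ℝ) :
    ‖joinLast x z‖ ^ 2 = ‖x‖ ^ 2 + z ^ 2 := by
  rw [← real_inner_self_eq_norm_sq, inner_joinLast, real_inner_self_eq_norm_sq, sq z]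

lemma smul_joinLast {n : ℕ} (r : ℝ) (x : EuclideanSpace ℝ (Fin n)) (z : ℝ) :
    r • joinLast x z = joinLast (r • x) (r * z) := by
  ext i
  refine Fin.lastCases ?_ (fun i => ?_) i
  · simp [joinLast_last]
  · simp [joinLast_castSucc]

lemma exists_eq_joinLast {n : ℕ} (x : EuclideanSpace ℝ (Fin (n + 1))) :
    ∃ x' : EuclideanSpace ℝ (Fin n), x = joinLast x' (x (Fin.last n)) := by
  refine ⟨WithLp.toLp 2 fun i => x i.castSucc, ?_⟩
  ext i
  refine Fin.lastCases ?_ (fun i => ?_) i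
  · simp [joinLast_last]
  · simp [joinLast_castSucc]

lemma measurePreserving_joinLast (n : ℕ) :
    MeasurePreserving
      (fun q : ℝ × EuclideanSpace ℝ (Fin n) => joinLast q.2 q.1) := by
  have h1 := (volume_preserving_piFinSuccAbove (fun _ : Fin (n + 1) => ℝ) (Fin.last n)).symm
  have h2 := PiLp.volume_preserving_toLp (Fin (n + 1))
  have h3 := (MeasurePreserving.id (volume : Measure ℝ)).prod (PiLp.volume_preserving_ofLp (Fin n))
  exact (h2.comp h1).comp h3

@[fun_prop]
lemma Measurable.joinLast {n : ℕ} {β : Type*} [MeasurableSpace β]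
    {f : β → EuclideanSpace ℝ (Fin n)} {g : β → ℝ} (hf : Measurable f) (hg : Measurable g) :
    Measurable fun b => joinLast (f b) (g b) :=
  (measurePreserving_joinLast n).measurable.comp (hg.prodMk hf)

lemma lintegral_polar {m : ℕ} {F : EuclideanSpace ℝ (Fin (m + 1)) → ℝ≥0∞} (hF : Measurable F) :
    ∫⁻ x, F x = ∫⁻ ω : Sph m, (∫⁻ r in Ioi (0 : ℝ), ENNReal.ofReal (r ^ m) *
      F (r • (ω : EuclideanSpace ℝ (Fin (m + 1))))) ∂(surf m) := by
  have hmp := (volume : Measure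
    (EuclideanSpace ℝ (Fin (m + 1)))).measurePreserving_homeomorphUnitSphereProd
  have hd : Module.finrank ℝ (EuclideanSpace ℝ (Fin (m + 1))) - 1 = m := by simp
  rw [hd] at hmp
  have hs := MeasurePreserving.symm (homeomorphUnitSphereProd
    (EuclideanSpace ℝ (Fin (m + 1)))).toMeasurableEquiv hmp
  calc ∫⁻ x, F x = ∫⁻ x : ({0}ᶜ : Set (EuclideanSpace ℝ (Fin (m + 1)))), F x
        ∂(volume.comap Subtype.val) := by
        rw [lintegral_subtype_comap (measurableSet_singleton _).compl, restrict_compl_singleton]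
    _ = ∫⁻ q : Sph m × Ioi (0 : ℝ), F (q.2.1 • (q.1 : EuclideanSpace ℝ (Fin (m + 1))))
          ∂((surf m).prod (Measure.volumeIoiPow m)) := by
        rw [← hs.lintegral_comp_emb (MeasurableEquiv.measurableEmbedding _)]
        rfl
    _ = _ := by
        rw [lintegral_prod]
        · refine lintegral_congr fun ω => ?_
          rw [Measure.volumeIoiPow, lintegral_withDensity_eq_lintegral_mul]
          · exact lintegral_subtype_comap measurableSet_Ioi (fun r : ℝ => ENNReal.ofReal (r ^ m) *
              F (r • (ω : EuclideanSpace ℝ (Fin (m + 1)))))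
          · fun_prop
          · fun_prop
        · fun_prop

instance (n : ℕ) : IsFiniteMeasure (surf n) := by
  unfold surf; infer_instance

lemma lintegral_Ioo_pow (m : ℕ) :
    ∫⁻ r in Ioo (0 : ℝ) 1, ENNReal.ofReal (r ^ m) = ENNReal.ofReal (1 / (m + 1)) := by
  rw [restrict_Ioo_eq_restrict_Ioc, ← ofReal_integral_eq_lintegral_ofReal,
    ← intervalIntegral.integral_of_le zero_le_one]
  · simp
  · exact (intervalIntegral.intervalIntegrable_pow _).1
  · filter_upwards [ae_restrict_mem measurableSet_Ioc] with y hy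
    exact pow_nonneg hy.1.le _

/-- Integration over `S^{m+1}` in the coordinates `(η, θ) ↦ (sin θ · η, cos θ)`. -/
lemma lintegral_surf_eq {m : ℕ} {f : EuclideanSpace ℝ (Fin (m + 1 + 1)) → ℝ≥0∞}
    (hf : Measurable f) :
    ∫⁻ y : Sph (m + 1), f y ∂(surf (m + 1)) =
      ∫⁻ θ in Ioo 0 Real.pi, ENNReal.ofReal (Real.sin θ ^ m) *
        ∫⁻ η : Sph m, f (joinLast (Real.sin θ • (η : EuclideanSpace ℝ (Fin (m + 1))))
          (Real.cos θ)) ∂(surf m) := by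
  -- The degree-zero homogeneous extension of `f`, cut off to the unit ball, is integrated twice: in
  -- polar coordinates of the whole space, and in cylindrical coordinates followed by polar
  -- coordinates of the half-plane. Both results carry the radial factor 1/(m + 2), which is
  -- cancelled at the end.
  set F : EuclideanSpace ℝ (Fin (m + 1 + 1)) → ℝ≥0∞ :=
    fun x => (Metric.ball 0 1).indicator (fun x => f (‖x‖⁻¹ • x)) x with hFdef
  have hF : Measurable F := Measurable.indicator (by fun_prop) measurableSet_ball
  have hFs : ∀ (r : ℝ) (v : EuclideanSpace ℝ (Fin (m + 1 + 1))), 0 < r → ‖v‖ = 1 →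
      F (r • v) = (Iio (1 : ℝ)).indicator (fun _ => f v) r := by
    intro r v hr hv
    have hn : ‖r • v‖ = r := by rw [norm_smul, hv, Real.norm_of_nonneg hr.le, mul_one]
    simp only [hFdef, indicator, mem_ball_zero_iff, hn, mem_Iio]
    rw [smul_smul, inv_mul_cancel₀ hr.ne', one_smul]
  have hrad : ∀ v : EuclideanSpace ℝ (Fin (m + 1 + 1)), ‖v‖ = 1 →
      ∫⁻ r in Ioi (0 : ℝ), ENNReal.ofReal (r ^ (m + 1)) * F (r • v) =
        ENNReal.ofReal (1 / ((m + 1 : ℕ) + 1)) * f v := by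
    intro v hv
    rw [← lintegral_Ioo_pow, ← lintegral_mul_const _ (by fun_prop), ← Ioi_inter_Iio,
      inter_comm, ← Measure.restrict_restrict measurableSet_Iio,
      ← lintegral_indicator measurableSet_Iio]
    refine setLIntegral_congr_fun measurableSet_Ioi fun r hr => ?_
    simp only [hFs r v hr hv, indicator]
    split_ifs <;> simp
  have hc0 : ENNReal.ofReal (1 / ((m + 1 : ℕ) + 1)) ≠ 0 := by
    simp only [ne_eq, ENNReal.ofReal_eq_zero, not_le]; positivity
  have h1 : ∫⁻ x, F x = ENNReal.ofReal (1 / ((m + 1 : ℕ) + 1)) *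
      ∫⁻ y : Sph (m + 1), f y ∂(surf (m + 1)) := by
    rw [lintegral_polar hF, ← lintegral_const_mul _ (by fun_prop)]
    exact lintegral_congr fun ω => hrad _ (by simp)
  have hnorm : ∀ (η : Sph m) (θ : ℝ), ‖joinLast (Real.sin θ • (η : EuclideanSpace ℝ (Fin (m + 1))))
          (Real.cos θ)‖ = 1 := by
    intro η θ
    rw [← sq_eq_sq₀ (norm_nonneg _) zero_le_one, norm_joinLast_sq, norm_smul]
    simp
  have h2 : ∫⁻ x, F x = ∫⁻ η : Sph m, (∫⁻ q : ℝ × ℝ, (Ioi (0 : ℝ)).indicator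
      (fun ρ => ENNReal.ofReal (ρ ^ m) * F (joinLast (ρ • (η : EuclideanSpace ℝ (Fin (m + 1))))
        q.1)) q.2) ∂(surf m) := by
    have hm : Measurable fun x : EuclideanSpace ℝ (Fin (m + 1)) => ∫⁻ z : ℝ, F (joinLast x z) := by
      refine Measurable.lintegral_prod_right' (f := fun q : EuclideanSpace ℝ (Fin (m + 1)) × ℝ =>
        F (joinLast q.1 q.2)) (by fun_prop)
    rw [← (measurePreserving_joinLast (m + 1)).lintegral_comp hF, Measure.volume_eq_prod,
      lintegral_prod_symm _ (by fun_prop), lintegral_polar hm]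
    refine lintegral_congr fun η => ?_
    rw [Measure.volume_eq_prod, lintegral_prod_symm, ← lintegral_indicator measurableSet_Ioi]
    · refine lintegral_congr fun ρ => ?_
      simp only [indicator]
      split_ifs
      · rw [lintegral_const_mul _ (by fun_prop)]
      · simp
    · refine Measurable.aemeasurable ?_
      have : (fun q : ℝ × ℝ => (Ioi (0 : ℝ)).indicator
        (fun ρ => ENNReal.ofReal (ρ ^ m) * F (joinLast (ρ • (η : EuclideanSpace ℝ (Fin (m + 1))))
        q.1)) q.2) = (Prod.snd ⁻¹' (Ioi (0 : ℝ))).indicator (fun q : ℝ × ℝ =>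
          ENNReal.ofReal (q.2 ^ m) * F (joinLast (q.2 • (η : EuclideanSpace ℝ (Fin (m + 1)))) q.1)) := by
        ext q; simp [indicator]
      rw [this]
      exact Measurable.indicator (by fun_prop) (measurable_snd measurableSet_Ioi)
  have h3 : ∀ η : Sph m, ∫⁻ q : ℝ × ℝ, (Ioi (0 : ℝ)).indicator
      (fun ρ => ENNReal.ofReal (ρ ^ m) * F (joinLast (ρ • (η : EuclideanSpace ℝ (Fin (m + 1))))
        q.1)) q.2 = ENNReal.ofReal (1 / ((m + 1 : ℕ) + 1)) *
        ∫⁻ θ in Ioo 0 Real.pi, ENNReal.ofReal (Real.sin θ ^ m) *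
          f (joinLast (Real.sin θ • (η : EuclideanSpace ℝ (Fin (m + 1)))) (Real.cos θ)) := by
    intro η
    -- Here z = r cos θ and ρ = r sin θ. The Jacobian r and the density ρ^m combine to r^{m+1} sin^m
    -- θ, and the condition ρ > 0 discards the angles θ ≤ 0.
    rw [← lintegral_comp_polarCoord_symm]
    have hmeas : Measurable fun q : ℝ × ℝ => ENNReal.ofReal (q.1 ^ (m + 1) * Real.sin q.2 ^ m) *
        F (q.1 • joinLast (Real.sin q.2 • (η : EuclideanSpace ℝ (Fin (m + 1)))) (Real.cos q.2)) := by
      fun_prop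
    calc _ = ∫⁻ q : ℝ × ℝ in Ioi 0 ×ˢ Ioo 0 Real.pi,
          ENNReal.ofReal (q.1 ^ (m + 1) * Real.sin q.2 ^ m) *
          F (q.1 • joinLast (Real.sin q.2 • (η : EuclideanSpace ℝ (Fin (m + 1))))
            (Real.cos q.2)) := by
          rw [← lintegral_indicator (measurableSet_Ioi.prod measurableSet_Ioo),
            ← lintegral_indicator polarCoord.open_target.measurableSet]
          refine lintegral_congr fun q => ?_
          obtain ⟨r, θ⟩ := q
          have htgt : (r, θ) ∈ polarCoord.target ↔ 0 < r ∧ θ ∈ Ioo (-Real.pi) Real.pi := Iff.rfl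
          have hset : (r, θ) ∈ Ioi (0 : ℝ) ×ˢ Ioo 0 Real.pi ↔ 0 < r ∧ θ ∈ Ioo 0 Real.pi := Iff.rfl
          by_cases hr : 0 < r
          · by_cases hθ : θ ∈ Ioo (-Real.pi) Real.pi
            · rw [indicator_of_mem (htgt.2 ⟨hr, hθ⟩)]
              simp only [polarCoord_symm_apply]
              by_cases hθ0 : 0 < θ
              · have hs : 0 < Real.sin θ := Real.sin_pos_of_pos_of_lt_pi hθ0 hθ.2
                rw [indicator_of_mem (hset.2 ⟨hr, hθ0, hθ.2⟩),
                  indicator_of_mem (mem_Ioi.2 (mul_pos hr hs)), smul_joinLast, smul_smul,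
                  smul_eq_mul, ← mul_assoc, ← ENNReal.ofReal_mul hr.le]
                congr 2
                ring
              · have hs : Real.sin θ ≤ 0 :=
                  Real.sin_nonpos_of_nonpos_of_neg_pi_le (not_lt.1 hθ0) hθ.1.le
                rw [indicator_of_notMem (s := Ioi (0 : ℝ) ×ˢ Ioo 0 Real.pi)
                  (fun h => hθ0 (hset.1 h).2.1), indicator_of_notMem, smul_zero]
                exact not_lt.2 (mul_nonpos_of_nonneg_of_nonpos hr.le hs)
            · rw [indicator_of_notMem (fun h => hθ (htgt.1 h).2), indicator_of_notMem]
              rintro ⟨-, h⟩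
              exact hθ ⟨by linarith [h.1, Real.pi_pos], h.2⟩
          · rw [indicator_of_notMem (fun h => hr h.1), indicator_of_notMem (fun h => hr h.1)]
      _ = ∫⁻ θ in Ioo 0 Real.pi, ∫⁻ r in Ioi (0 : ℝ),
          ENNReal.ofReal (r ^ (m + 1) * Real.sin θ ^ m) *
          F (r • joinLast (Real.sin θ • (η : EuclideanSpace ℝ (Fin (m + 1))))
            (Real.cos θ)) := by
          rw [Measure.volume_eq_prod, ← Measure.prod_restrict,
            lintegral_prod_symm _ hmeas.aemeasurable]
      _ = _ := by
          rw [← lintegral_const_mul _ (by fun_prop)]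
          refine setLIntegral_congr_fun measurableSet_Ioo fun θ hθ => ?_
          have hs : 0 ≤ Real.sin θ := (Real.sin_pos_of_pos_of_lt_pi hθ.1 hθ.2).le
          rw [mul_left_comm, ← hrad _ (hnorm η θ), ← lintegral_const_mul _ (by fun_prop)]
          refine lintegral_congr fun r => ?_
          rw [mul_comm (r ^ _), ENNReal.ofReal_mul (pow_nonneg hs _), mul_assoc]
  have h4 := h1.symm.trans h2
  simp_rw [h3] at h4
  rw [lintegral_const_mul] at h4
  · rw [(ENNReal.mul_right_inj hc0 ENNReal.ofReal_ne_top).1 h4, lintegral_lintegral_swap]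
    · refine lintegral_congr fun θ => ?_
      rw [lintegral_const_mul _ (by fun_prop)]
    · fun_prop
  · exact Measurable.lintegral_prod_right' (f := fun q : Sph m × ℝ =>
      ENNReal.ofReal (Real.sin q.2 ^ m) * f (joinLast (Real.sin q.2 •
        (q.1 : EuclideanSpace ℝ (Fin (m + 1)))) (Real.cos q.2))) (by fun_prop)

/-! ### Invariance of the surface measure under isometries. -/

/-- The action of a linear isometry on the unit sphere. -/
noncomputable def sphMap {n : ℕ} (L : EuclideanSpace ℝ (Fin (n + 1)) ≃ₗᵢ[ℝ] EuclideanSpace ℝ (Fin (n + 1)))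
    (x : Sph n) : Sph n :=
  ⟨L x, by simp⟩

-- The surface measure of a set is a constant times the volume of the cone over it. A linear
-- isometry commutes with forming cones and preserves volume.
open scoped Pointwise in
lemma measurePreserving_sphMap {n : ℕ}
    (L : EuclideanSpace ℝ (Fin (n + 1)) ≃ₗᵢ[ℝ] EuclideanSpace ℝ (Fin (n + 1))) :
    MeasurePreserving (sphMap L) (surf n) (surf n) := by
  have hm : Measurable (sphMap L) :=
    (L.continuous.measurable.comp measurable_subtype_coe).subtype_mk
  refine ⟨hm, ?_⟩
  ext s hs
  rw [Measure.map_apply hm hs, surf, Measure.toSphere_apply' _ (hm hs), Measure.toSphere_apply' _ hs]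
  congr 1
  have hL : MeasurePreserving L.toMeasurableEquiv volume volume := L.measurePreserving
  rw [← hL.measure_preimage_equiv (Ioo (0 : ℝ) 1 • (Subtype.val '' s))]
  congr 1
  ext x
  simp only [mem_smul, mem_preimage, mem_image]
  constructor
  · rintro ⟨r, hr, _, ⟨y, hy, rfl⟩, rfl⟩
    exact ⟨r, hr, L y, ⟨sphMap L y, hy, rfl⟩, by simp⟩
  · rintro ⟨r, hr, _, ⟨y, hy, rfl⟩, h⟩
    refine ⟨r, hr, L.symm y, ⟨⟨L.symm y, by simp⟩, ?_, rfl⟩, ?_⟩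
    · simpa [sphMap] using hy
    · rw [← map_smul, h]; exact L.symm_apply_apply x

/-! ### Averages of the Poisson kernel. -/

lemma lintegral_inv_add_mul_sq {u v : ℝ} (hu : 0 < u) (hv : 0 < v) :
    ∫⁻ θ : ℝ, ENNReal.ofReal ((u + v * θ ^ 2)⁻¹) = ENNReal.ofReal (Real.pi / √(u * v)) := by
  have hc : 0 < √(v / u) := Real.sqrt_pos.2 (div_pos hv hu)
  have heq : ∀ θ : ℝ, (u + v * θ ^ 2)⁻¹ = u⁻¹ * (1 + (√(v / u) * θ) ^ 2)⁻¹ := by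
    intro θ
    rw [mul_pow, Real.sq_sqrt (div_pos hv hu).le, ← mul_inv]
    congr 1
    field_simp
  simp_rw [heq]
  rw [← ofReal_integral_eq_lintegral_ofReal]
  · rw [integral_const_mul, Measure.integral_comp_mul_left (fun x : ℝ => (1 + x ^ 2)⁻¹),
      integral_univ_inv_one_add_sq, abs_of_pos (inv_pos.2 hc), smul_eq_mul]
    congr 1
    have : √(u * v) = u * √(v / u) := by
      rw [← Real.sqrt_sq hu.le, ← Real.sqrt_mul (sq_nonneg u), Real.sqrt_sq hu.le]
      congr 1
      field_simp
    rw [this]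
    field_simp
  · exact (integrable_inv_one_add_sq.comp_mul_left' hc.ne').const_mul _
  · exact Filter.Eventually.of_forall fun θ => by positivity

/-- In half angles, A - B cos θ = (A - B) cos²(θ/2) + (A + B) sin²(θ/2). -/
lemma mul_sin_sq_half_le {A B θ : ℝ} (hB : 0 ≤ B) (hAB : B ≤ A) :
    A * Real.sin (θ / 2) ^ 2 ≤ A - B * Real.cos θ := by
  have h := Real.cos_two_mul (θ / 2)
  rw [mul_div_cancel₀ θ two_ne_zero] at h
  have h' := Real.sin_sq_add_cos_sq (θ / 2)
  nlinarith [mul_nonneg (sub_nonneg.2 hAB) (sq_nonneg (Real.cos (θ / 2))),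
    mul_nonneg hB (sq_nonneg (Real.sin (θ / 2)))]

/-- This lets the density sin^k θ absorb k/2 powers of A - B cos θ, so that the average over a
sphere of any dimension reduces to the integral of (A - B cos θ)⁻¹. -/
lemma mul_sin_sq_le {A B θ : ℝ} (hB : 0 ≤ B) (hAB : B ≤ A) :
    A * Real.sin θ ^ 2 ≤ 4 * (A - B * Real.cos θ) := by
  have h := mul_sin_sq_half_le (θ := θ) hB hAB
  have hs : Real.sin θ = 2 * Real.sin (θ / 2) * Real.cos (θ / 2) := by
    rw [← Real.sin_two_mul]; ring_nf
  have hc : Real.cos (θ / 2) ^ 2 ≤ 1 := Real.cos_sq_le_one _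
  have : A * Real.sin θ ^ 2 = 4 * (A * Real.sin (θ / 2) ^ 2) * Real.cos (θ / 2) ^ 2 := by
    rw [hs]; ring
  rw [this]
  have h0 : 0 ≤ A * Real.sin (θ / 2) ^ 2 := mul_nonneg (hB.trans hAB) (sq_nonneg _)
  nlinarith

/-- The bound `∫_0^π dθ / (A - B cos θ) ≤ C / √(A² - B²)`. -/
lemma lintegral_inv_sub_mul_cos_le {A B : ℝ} (hB : 0 ≤ B) (hAB : B < A) :
    ∫⁻ θ in Ioo 0 Real.pi, ENNReal.ofReal ((A - B * Real.cos θ)⁻¹) ≤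
      ENNReal.ofReal (4 * Real.pi ^ 2 / √(A ^ 2 - B ^ 2)) := by
  have hA : 0 < A := hB.trans_lt hAB
  have hpi := Real.pi_pos
  -- The denominator is at least A - B, and by Jordan's inequality at least A θ²/π². The mean of
  -- these two bounds is a quadratic in θ whose reciprocal integrates over the line to an arctangent
  -- integral.
  have hu : 0 < (A - B) / 2 := by linarith
  have hv : 0 < A / (2 * Real.pi ^ 2) := by positivity
  calc ∫⁻ θ in Ioo 0 Real.pi, ENNReal.ofReal ((A - B * Real.cos θ)⁻¹)
      ≤ ∫⁻ θ in Ioo 0 Real.pi, ENNReal.ofReal (((A - B) / 2 + A / (2 * Real.pi ^ 2) * θ ^ 2)⁻¹) := by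
        refine setLIntegral_mono' measurableSet_Ioo fun θ hθ => ?_
        refine ENNReal.ofReal_le_ofReal (inv_anti₀ (by positivity) ?_)
        have h1 := mul_sin_sq_half_le (θ := θ) hB hAB.le
        have h2 : 2 / Real.pi * (θ / 2) ≤ Real.sin (θ / 2) :=
          Real.mul_le_sin (by linarith [hθ.1]) (by linarith [hθ.2])
        have h3 : (θ / Real.pi) ^ 2 ≤ Real.sin (θ / 2) ^ 2 := by
          refine pow_le_pow_left₀ (div_nonneg hθ.1.le hpi.le) ?_ 2
          calc θ / Real.pi = 2 / Real.pi * (θ / 2) := by ring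
            _ ≤ _ := h2
        have h4 : A * (θ / Real.pi) ^ 2 ≤ A - B * Real.cos θ :=
          (mul_le_mul_of_nonneg_left h3 hA.le).trans h1
        have h5 : A - B ≤ A - B * Real.cos θ := by nlinarith [Real.cos_le_one θ]
        have h6 : A / (2 * Real.pi ^ 2) * θ ^ 2 = A * (θ / Real.pi) ^ 2 / 2 := by
          field_simp
        linarith
    _ ≤ ∫⁻ θ, ENNReal.ofReal (((A - B) / 2 + A / (2 * Real.pi ^ 2) * θ ^ 2)⁻¹) :=
        setLIntegral_le_lintegral _ _
    _ = ENNReal.ofReal (Real.pi / √((A - B) / 2 * (A / (2 * Real.pi ^ 2)))) :=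
        lintegral_inv_add_mul_sq hu hv
    _ ≤ _ := by
        refine ENNReal.ofReal_le_ofReal ?_
        have hAB2 : 0 < A ^ 2 - B ^ 2 := by nlinarith
        have hs : √(A ^ 2 - B ^ 2) ≤ 4 * Real.pi * √((A - B) / 2 * (A / (2 * Real.pi ^ 2))) := by
          rw [Real.sqrt_le_left (by positivity), mul_pow, Real.sq_sqrt (by positivity)]
          have : (4 * Real.pi) ^ 2 * ((A - B) / 2 * (A / (2 * Real.pi ^ 2))) =
            4 * (A * (A - B)) := by
            field_simp; ring
          rw [this]
          nlinarith
        rw [div_le_div_iff₀ (by positivity) (by positivity)]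
        nlinarith [mul_le_mul_of_nonneg_left hs hpi.le]

/-- The estimate of the Poisson kernel on a sphere, averaged over the sphere. -/
lemma exists_lintegral_inner_rpow_le (k : ℕ) : ∃ C : ℝ≥0, ∀ (A B : ℝ) (ξ : Sph (k + 1)),
    0 ≤ B → B < A →
    ∫⁻ η : Sph (k + 1), ENNReal.ofReal ((A - B * inner ℝ (ξ : EuclideanSpace ℝ (Fin (k + 1 + 1)))
      (η : EuclideanSpace ℝ (Fin (k + 1 + 1)))) ^ (-((k : ℝ) + 2) / 2)) ∂(surf (k + 1)) ≤
    C * ENNReal.ofReal (A ^ (-(k : ℝ) / 2) / √(A ^ 2 - B ^ 2)) := by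
  refine ⟨(surf k univ).toNNReal * (4 ^ ((k : ℝ) / 2) * (4 * Real.pi ^ 2)).toNNReal, ?_⟩
  intro A B ξ hB hAB
  have hA : 0 < A := hB.trans_lt hAB
  set N : EuclideanSpace ℝ (Fin (k + 1 + 1)) := joinLast 0 1 with hN
  have hNn : ‖N‖ = 1 := by
    rw [← sq_eq_sq₀ (norm_nonneg _) zero_le_one, hN, norm_joinLast_sq]; simp
  have hξ : ‖(ξ : EuclideanSpace ℝ (Fin (k + 1 + 1)))‖ = 1 := by simp
  -- The reflection in the hyperplane orthogonal to N - ξ takes the pole N to ξ, so ξ may be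
  -- replaced by the pole.
  set L := Submodule.reflection (ℝ ∙ (N - ξ))ᗮ
  have hL : L N = ξ := Submodule.reflection_sub (hNn.trans hξ.symm)
  have hrot : ∫⁻ η : Sph (k + 1), ENNReal.ofReal ((A - B * inner ℝ
      (ξ : EuclideanSpace ℝ (Fin (k + 1 + 1)))
      (η : EuclideanSpace ℝ (Fin (k + 1 + 1)))) ^ (-((k : ℝ) + 2) / 2)) ∂(surf (k + 1)) =
      ∫⁻ η : Sph (k + 1), ENNReal.ofReal ((A - B * inner ℝ N
      (η : EuclideanSpace ℝ (Fin (k + 1 + 1)))) ^ (-((k : ℝ) + 2) / 2)) ∂(surf (k + 1)) := by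
    rw [← (measurePreserving_sphMap L).lintegral_comp (by fun_prop)]
    refine lintegral_congr fun η => ?_
    rw [← hL]
    simp only [sphMap, LinearIsometryEquiv.inner_map_map]
  rw [hrot, lintegral_surf_eq (f := fun η => ENNReal.ofReal ((A - B * inner ℝ N η) ^
    (-((k : ℝ) + 2) / 2))) (by fun_prop)]
  simp only [hN, inner_joinLast, inner_zero_left, one_mul, zero_add, lintegral_const]
  calc _ ≤ ∫⁻ θ in Ioo 0 Real.pi, surf k univ * ENNReal.ofReal (4 ^ ((k : ℝ) / 2) *
        A ^ (-(k : ℝ) / 2)) * ENNReal.ofReal ((A - B * Real.cos θ)⁻¹) := by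
        refine setLIntegral_mono' measurableSet_Ioo fun θ hθ => ?_
        have hs := (Real.sin_pos_of_pos_of_lt_pi hθ.1 hθ.2)
        have hD : 0 < A - B * Real.cos θ := by nlinarith [Real.cos_le_one θ]
        rw [mul_comm _ (surf k univ), mul_left_comm, mul_assoc, ← ENNReal.ofReal_mul (by positivity),
          ← ENNReal.ofReal_mul (by positivity)]
        refine mul_le_mul' le_rfl (ENNReal.ofReal_le_ofReal ?_)
        have h1 : Real.sin θ ^ 2 ≤ 4 * A⁻¹ * (A - B * Real.cos θ) := by
          have := mul_sin_sq_le (θ := θ) hB hAB.le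
          rw [mul_assoc, ← div_eq_inv_mul, mul_div_assoc', le_div_iff₀ hA]
          linarith
        have h2 : Real.sin θ ^ k ≤ 4 ^ ((k : ℝ) / 2) * A ^ (-(k : ℝ) / 2) *
            (A - B * Real.cos θ) ^ ((k : ℝ) / 2) := by
          calc Real.sin θ ^ k = (Real.sin θ ^ 2) ^ ((k : ℝ) / 2) := by
                rw [← Real.rpow_natCast, ← Real.rpow_natCast, ← Real.rpow_mul hs.le]
                congr 1; push_cast; ring
            _ ≤ (4 * A⁻¹ * (A - B * Real.cos θ)) ^ ((k : ℝ) / 2) :=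
                Real.rpow_le_rpow (by positivity) h1 (by positivity)
            _ = _ := by
                rw [Real.mul_rpow (by positivity) hD.le, Real.mul_rpow (by positivity)
                  (by positivity), Real.inv_rpow hA.le, ← Real.rpow_neg hA.le, neg_div]
        calc _ ≤ 4 ^ ((k : ℝ) / 2) * A ^ (-(k : ℝ) / 2) *
            (A - B * Real.cos θ) ^ ((k : ℝ) / 2) * (A - B * Real.cos θ) ^ (-((k : ℝ) + 2) / 2) :=
              mul_le_mul_of_nonneg_right h2 (by positivity)
          _ = _ := by
              rw [mul_assoc _ (_ ^ _) (_ ^ _), ← Real.rpow_add hD, ← Real.rpow_neg_one]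
              congr 2; ring
    _ = surf k univ * ENNReal.ofReal (4 ^ ((k : ℝ) / 2) *
        A ^ (-(k : ℝ) / 2)) * ∫⁻ θ in Ioo 0 Real.pi, ENNReal.ofReal ((A - B * Real.cos θ)⁻¹) :=
        lintegral_const_mul _ (by fun_prop)
    _ ≤ surf k univ * ENNReal.ofReal (4 ^ ((k : ℝ) / 2) * A ^ (-(k : ℝ) / 2)) *
        ENNReal.ofReal (4 * Real.pi ^ 2 / √(A ^ 2 - B ^ 2)) := by
        gcongr; exact lintegral_inv_sub_mul_cos_le hB hAB
    _ = _ := by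
        rw [ENNReal.coe_mul, ENNReal.coe_toNNReal (measure_ne_top _ _), mul_assoc, mul_assoc,
          ← ENNReal.ofReal_mul (by positivity)]
        congr 1
        rw [← ENNReal.ofReal, ← ENNReal.ofReal_mul (by positivity)]
        congr 1
        ring

/-! ### Reduction of the kernel to one variable. -/

lemma lintegral_Ioo_comp_cos (g : ℝ → ℝ≥0∞) :
    ∫⁻ θ in Ioo 0 Real.pi, ENNReal.ofReal (Real.sin θ) * g (Real.cos θ) =
      ∫⁻ s in Ioo (-1) 1, g s := by
  have himg : Real.cos '' Ioo 0 Real.pi = Ioo (-1) 1 := by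
    ext s
    constructor
    · rintro ⟨θ, hθ, rfl⟩
      have h1 := Real.cos_lt_cos_of_nonneg_of_le_pi le_rfl hθ.2.le hθ.1
      have h2 := Real.cos_lt_cos_of_nonneg_of_le_pi hθ.1.le le_rfl hθ.2
      rw [Real.cos_zero] at h1
      rw [Real.cos_pi] at h2
      exact ⟨h2, h1⟩
    · intro hs
      exact ⟨Real.arccos s, ⟨Real.arccos_pos.2 hs.2, lt_of_le_of_ne (Real.arccos_le_pi s)
        fun h => absurd (Real.arccos_eq_pi.1 h) (not_le.2 hs.1)⟩, Real.cos_arccos hs.1.le hs.2.le⟩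
  rw [← himg, lintegral_image_eq_lintegral_abs_deriv_mul measurableSet_Ioo
    (fun θ _ => (Real.hasDerivAt_cos θ).hasDerivWithinAt)
    (Real.injOn_cos.mono Ioo_subset_Icc_self)]
  refine setLIntegral_congr_fun measurableSet_Ioo fun θ hθ => ?_
  rw [abs_neg, abs_of_pos (Real.sin_pos_of_pos_of_lt_pi hθ.1 hθ.2)]

/-- The kernel `(x_{n+1} - y_{n+1})_+^α |x - y|^{-n}` of the left-sided integral. -/
noncomputable def leftKernel {n : ℕ} (α : ℝ) (x y : Sph n) : ℝ≥0∞ :=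
  if lastCoord y < lastCoord x then
    ENNReal.ofReal ((lastCoord x - lastCoord y) ^ α /
      ‖(x : EuclideanSpace ℝ (Fin (n + 1))) - y‖ ^ n) else 0

/-- The identity (1 - ts)² - (1 - t²)(1 - s²) = (t - s)² turns √(A² - B²) in the Poisson bound into
the distance of the heights. -/
lemma one_sub_mul_sq_sub {t s : ℝ} (ht : t ^ 2 ≤ 1) (hs : s ^ 2 ≤ 1) (hst : s < t) :
    √((2 * (1 - t * s)) ^ 2 - (2 * (√(1 - t ^ 2) * √(1 - s ^ 2))) ^ 2) = 2 * (t - s) := by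
  rw [mul_pow, mul_pow, mul_pow, Real.sq_sqrt (by linarith), Real.sq_sqrt (by linarith)]
  rw [show 2 ^ 2 * (1 - t * s) ^ 2 - 2 ^ 2 * ((1 - t ^ 2) * (1 - s ^ 2)) = (2 * (t - s)) ^ 2 by ring]
  exact Real.sqrt_sq (by linarith)

/-- Integrating the kernel against a function of the last coordinate reduces to a
one-dimensional fractional integral. -/
lemma exists_lintegral_leftKernel_mul_le (k : ℕ) (α : ℝ) : ∃ C : ℝ≥0, ∀ (g : ℝ → ℝ≥0∞),
    Measurable g → ∀ x : Sph (k + 2), lastCoord x ∈ Ioo (-1) 1 →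
    ∫⁻ y, leftKernel α x y * g (lastCoord y) ∂(surf (k + 2)) ≤
      C * ∫⁻ s in Ioo (-1) (lastCoord x), ENNReal.ofReal ((1 + lastCoord x) ^ (-(k : ℝ) / 2) *
        ((lastCoord x - s) ^ (α - 1) * (1 + s) ^ ((k : ℝ) / 2))) * g s := by
  obtain ⟨C, hC⟩ := exists_lintegral_inner_rpow_le k
  refine ⟨C, fun g hg x hx => ?_⟩
  set t := lastCoord x with ht
  have ht1 : 0 < 1 + t := by linarith [hx.1]
  have ht2 : 0 < 1 - t := by linarith [hx.2]
  have htsq : 0 < 1 - t ^ 2 := by nlinarith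
  obtain ⟨x', hx'⟩ := exists_eq_joinLast (x : EuclideanSpace ℝ (Fin (k + 2 + 1)))
  change _ = joinLast x' t at hx'
  have hxn : ‖x'‖ = √(1 - t ^ 2) := by
    have h1 := norm_joinLast_sq x' t
    rw [← hx', norm_eq_of_mem_sphere] at h1
    rw [← Real.sqrt_sq (norm_nonneg x')]
    congr 1
    linarith
  have hx0 : 0 < ‖x'‖ := by rw [hxn]; exact Real.sqrt_pos.2 htsq
  set ξ : Sph (k + 1) := ⟨‖x'‖⁻¹ • x', by simp [norm_smul, hx0.ne']⟩ with hξ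
  have hxξ : x' = √(1 - t ^ 2) • (ξ : EuclideanSpace ℝ (Fin (k + 1 + 1))) := by
    rw [← hxn, hξ, smul_smul, mul_inv_cancel₀ hx0.ne', one_smul]
  set f : EuclideanSpace ℝ (Fin (k + 1 + 1 + 1)) → ℝ≥0∞ := fun v =>
    {v : EuclideanSpace ℝ (Fin (k + 1 + 1 + 1)) | v (Fin.last _) < t}.indicator
      (fun v => ENNReal.ofReal ((t - v (Fin.last _)) ^ α /
        ‖(x : EuclideanSpace ℝ (Fin (k + 2 + 1))) - v‖ ^ (k + 2)) * g (v (Fin.last _))) v with hf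
  have hfm : Measurable f := by
    refine Measurable.indicator (by fun_prop) (measurableSet_lt (by fun_prop) (by fun_prop))
  have hLHS : ∫⁻ y, leftKernel α x y * g (lastCoord y) ∂(surf (k + 2)) =
      ∫⁻ y : Sph (k + 1 + 1), f y ∂(surf (k + 1 + 1)) := by
    refine lintegral_congr fun y => ?_
    simp only [leftKernel, hf, indicator, mem_ofPred_eq, ite_mul, zero_mul]
    rfl
  rw [hLHS, lintegral_surf_eq hfm]
  set G : ℝ → ℝ≥0∞ := fun s => (Iio t).indicator (fun s => C * (ENNReal.ofReal
    ((1 + t) ^ (-(k : ℝ) / 2) * ((t - s) ^ (α - 1) * (1 + s) ^ ((k : ℝ) / 2))) * g s)) s with hG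
  have hle : ∀ θ ∈ Ioo 0 Real.pi, ENNReal.ofReal (Real.sin θ ^ (k + 1)) *
        ∫⁻ η : Sph (k + 1), f (joinLast (Real.sin θ • (η : EuclideanSpace ℝ (Fin (k + 1 + 1))))
          (Real.cos θ)) ∂(surf (k + 1)) ≤ ENNReal.ofReal (Real.sin θ) * G (Real.cos θ) := by
    intro θ hθ
    have hsin : 0 < Real.sin θ := Real.sin_pos_of_pos_of_lt_pi hθ.1 hθ.2
    have hsc := Real.sin_sq_add_cos_sq θ
    set s := Real.cos θ with hs
    have hs1 : 0 < 1 + s := by nlinarith [Real.neg_one_le_cos θ]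
    have hs2 : 0 < 1 - s := by nlinarith [Real.cos_le_one θ]
    have hsqrt : Real.sin θ = √(1 - s ^ 2) := by
      rw [← Real.sqrt_sq hsin.le]; congr 1; linarith
    by_cases hst : s < t
    -- The difference of the two sides is (1 + s)(1 - t).
    · have hA : (1 + t) * (1 - s) ≤ 2 * (1 - t * s) := by nlinarith
      have hd := one_sub_mul_sq_sub (t := t) (s := s) (by linarith) (by nlinarith) hst
      rw [← hsqrt] at hd
      have hBA : 2 * (√(1 - t ^ 2) * Real.sin θ) < 2 * (1 - t * s) := by
        have h0 : 0 < √((2 * (1 - t * s)) ^ 2 - (2 * (√(1 - t ^ 2) * Real.sin θ)) ^ 2) := by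
          rw [hd]; linarith
        have := Real.sqrt_pos.1 h0
        refine lt_of_pow_lt_pow_left₀ 2 ?_ (by linarith)
        nlinarith
      have hfeq : ∀ η : Sph (k + 1),
          f (joinLast (Real.sin θ • (η : EuclideanSpace ℝ (Fin (k + 1 + 1)))) s) =
          (ENNReal.ofReal ((t - s) ^ α) * g s) *
            ENNReal.ofReal ((2 * (1 - t * s) - 2 * (√(1 - t ^ 2) * Real.sin θ) *
            inner ℝ (ξ : EuclideanSpace ℝ (Fin (k + 1 + 1)))
              (η : EuclideanSpace ℝ (Fin (k + 1 + 1)))) ^ (-((k : ℝ) + 2) / 2)) := by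
        intro η
        have hxy : ‖(x : EuclideanSpace ℝ (Fin (k + 2 + 1))) - joinLast (Real.sin θ •
            (η : EuclideanSpace ℝ (Fin (k + 1 + 1)))) s‖ ^ 2 =
            2 * (1 - t * s) - 2 * (√(1 - t ^ 2) * Real.sin θ) *
            inner ℝ (ξ : EuclideanSpace ℝ (Fin (k + 1 + 1)))
              (η : EuclideanSpace ℝ (Fin (k + 1 + 1))) := by
          rw [norm_sub_sq_real, norm_joinLast_sq, norm_smul, norm_eq_of_mem_sphere, hx',
            inner_joinLast, hxξ, real_inner_smul_left, real_inner_smul_right,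
            norm_eq_of_mem_sphere, Real.norm_eq_abs, mul_one, sq_abs]
          linear_combination hsc
        simp only [hf]
        rw [indicator_of_mem (by simpa [joinLast_last] using hst), joinLast_last, ← hxy,
          div_eq_mul_inv, ENNReal.ofReal_mul (Real.rpow_nonneg (by linarith) _), mul_right_comm]
        congr 2
        rw [← Real.rpow_natCast _ 2, ← Real.rpow_mul (norm_nonneg _), ← Real.rpow_natCast,
          ← Real.rpow_neg (norm_nonneg _)]
        congr 1
        push_cast
        ring
      simp_rw [hfeq]
      rw [lintegral_const_mul _ (by fun_prop)]
      have hin := hC (2 * (1 - t * s)) (2 * (√(1 - t ^ 2) * Real.sin θ)) ξ (by positivity) hBA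
      rw [hd] at hin
      simp only [hG]
      rw [indicator_of_mem (mem_Iio.2 hst)]
      calc _ ≤ ENNReal.ofReal (Real.sin θ ^ (k + 1)) * (ENNReal.ofReal ((t - s) ^ α) * g s *
            (C * ENNReal.ofReal ((2 * (1 - t * s)) ^ (-(k : ℝ) / 2) / (2 * (t - s))))) :=
            mul_le_mul' le_rfl (mul_le_mul' le_rfl hin)
        _ = C * g s * (ENNReal.ofReal (Real.sin θ ^ (k + 1)) * ENNReal.ofReal ((t - s) ^ α) *
            ENNReal.ofReal ((2 * (1 - t * s)) ^ (-(k : ℝ) / 2) / (2 * (t - s)))) := by ring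
        _ ≤ C * g s * (ENNReal.ofReal (Real.sin θ) * ENNReal.ofReal
            ((1 + t) ^ (-(k : ℝ) / 2) * ((t - s) ^ (α - 1) * (1 + s) ^ ((k : ℝ) / 2)))) := by
            refine mul_le_mul' le_rfl ?_
            have hts : 0 < t - s := by linarith
            rw [← ENNReal.ofReal_mul (by positivity), ← ENNReal.ofReal_mul (by positivity),
              ← ENNReal.ofReal_mul (by positivity)]
            refine ENNReal.ofReal_le_ofReal ?_
            have h1 : (2 * (1 - t * s)) ^ (-(k : ℝ) / 2) ≤
                (1 + t) ^ (-(k : ℝ) / 2) * (1 - s) ^ (-(k : ℝ) / 2) := by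
              rw [← Real.mul_rpow ht1.le hs2.le]
              refine Real.rpow_le_rpow_of_nonpos (by positivity) hA ?_
              rw [neg_div]
              exact neg_nonpos.2 (by positivity)
            -- The factor (1 - s)^{k/2} cancels against the lower bound for A, leaving no
            -- singularity at s = 1; the remaining power of sin θ is the Jacobian of s = cos θ.
            have h2 : Real.sin θ ^ k = (1 + s) ^ ((k : ℝ) / 2) * (1 - s) ^ ((k : ℝ) / 2) := by
              rw [← Real.mul_rpow hs1.le hs2.le, show (1 + s) * (1 - s) = Real.sin θ ^ 2 by
                linear_combination -hsc, ← Real.rpow_natCast, ← Real.rpow_natCast,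
                ← Real.rpow_mul hsin.le]
              congr 1; push_cast; ring
            have h3 : (t - s) ^ α = (t - s) ^ (α - 1) * (t - s) := by
              rw [← Real.rpow_add_one hts.ne']; ring_nf
            have h4 : (1 - s) ^ ((k : ℝ) / 2) * (1 - s) ^ (-(k : ℝ) / 2) = 1 := by
              rw [← Real.rpow_add hs2]; ring_nf; simp
            calc Real.sin θ ^ (k + 1) * (t - s) ^ α *
                ((2 * (1 - t * s)) ^ (-(k : ℝ) / 2) / (2 * (t - s)))
                ≤ Real.sin θ ^ (k + 1) * (t - s) ^ α *
                (((1 + t) ^ (-(k : ℝ) / 2) * (1 - s) ^ (-(k : ℝ) / 2)) / (1 * (t - s))) := by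
                  gcongr
                  norm_num
              _ = Real.sin θ * ((1 + t) ^ (-(k : ℝ) / 2) * ((t - s) ^ (α - 1) *
                  (1 + s) ^ ((k : ℝ) / 2))) *
                  ((1 - s) ^ ((k : ℝ) / 2) * (1 - s) ^ (-(k : ℝ) / 2)) := by
                  rw [pow_succ, h2, h3]
                  field_simp
              _ = _ := by rw [h4, mul_one]
        _ = _ := by ring
    · have : ∀ η : Sph (k + 1),
          f (joinLast (Real.sin θ • (η : EuclideanSpace ℝ (Fin (k + 1 + 1)))) s) = 0 := by
        intro η
        simp only [hf]
        rw [indicator_of_notMem (by simpa [joinLast_last] using hst)]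
      simp [this]
  calc _ ≤ ∫⁻ θ in Ioo 0 Real.pi, ENNReal.ofReal (Real.sin θ) * G (Real.cos θ) :=
        setLIntegral_mono' measurableSet_Ioo hle
    _ = ∫⁻ s in Ioo (-1) 1, G s := lintegral_Ioo_comp_cos G
    _ = _ := by
        rw [lintegral_indicator measurableSet_Iio, Measure.restrict_restrict measurableSet_Iio,
          lintegral_const_mul _ (by fun_prop)]
        congr 3
        ext s
        simp only [mem_inter_iff, mem_Iio, mem_Ioo]
        constructor
        · rintro ⟨h1, h2, h3⟩
          exact ⟨h2, h1⟩
        · rintro ⟨h1, h2⟩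
          exact ⟨h2, h1, h2.trans hx.2⟩

/-- The poles are null: the slice coordinates with 0 < θ < π never reach them. Hence the weights are
positive almost everywhere, whatever the signs of the exponents. -/
lemma ae_lastCoord_mem (k : ℕ) : ∀ᵐ x ∂(surf (k + 1)), lastCoord x ∈ Ioo (-1) 1 := by
  set f : EuclideanSpace ℝ (Fin (k + 1 + 1)) → ℝ≥0∞ := fun v =>
    (Ioo (-1 : ℝ) 1)ᶜ.indicator 1 (v (Fin.last _)) with hf
  have hfm : Measurable f :=
    (measurable_one.indicator measurableSet_Ioo.compl).comp (by fun_prop)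
  have h0 : ∫⁻ y : Sph (k + 1), f y ∂(surf (k + 1)) = 0 := by
    rw [lintegral_surf_eq hfm, setLIntegral_congr_fun (g := fun _ => 0) measurableSet_Ioo,
      lintegral_zero]
    intro θ hθ
    have hsin : 0 < Real.sin θ := Real.sin_pos_of_pos_of_lt_pi hθ.1 hθ.2
    have hsc := Real.sin_sq_add_cos_sq θ
    have hmem : Real.cos θ ∈ Ioo (-1 : ℝ) 1 :=
      ⟨by nlinarith [Real.neg_one_le_cos θ], by nlinarith [Real.cos_le_one θ]⟩
    simp only [hf, joinLast_last]
    rw [indicator_of_notMem (by simpa using hmem)]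
    simp
  rw [lintegral_eq_zero_iff (by fun_prop)] at h0
  filter_upwards [h0] with x hx
  by_contra hn
  have : f x = 1 := by
    simp only [hf]
    rw [indicator_of_mem (by exact hn)]
    rfl
  simp [this] at hx

/-! ### Weighted Riemann–Liouville estimates on (-1, 1). -/

lemma lintegral_Ioo_sub_left_rpow {a b c : ℝ} (hab : a < b) (hc : 0 < c) :
    ∫⁻ s in Ioo a b, ENNReal.ofReal ((s - a) ^ (c - 1)) = ENNReal.ofReal ((b - a) ^ c / c) := by
  have hi : IntervalIntegrable (fun s : ℝ => (s - a) ^ (c - 1)) volume a b := by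
    have := (intervalIntegral.intervalIntegrable_rpow' (a := 0) (b := b - a)
      (show -1 < c - 1 by linarith)).comp_sub_right a
    simpa using this
  rw [restrict_Ioo_eq_restrict_Ioc, ← ofReal_integral_eq_lintegral_ofReal hi.1,
    ← intervalIntegral.integral_of_le hab.le,
    intervalIntegral.integral_comp_sub_right (fun s => s ^ (c - 1)), sub_self,
    integral_rpow (Or.inl (by linarith)), sub_add_cancel, Real.zero_rpow hc.ne', sub_zero]
  filter_upwards [ae_restrict_mem measurableSet_Ioc] with y hy
  exact Real.rpow_nonneg (by linarith [hy.1]) _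

lemma lintegral_Ioo_sub_right_rpow {a b c : ℝ} (hab : a < b) (hc : 0 < c) :
    ∫⁻ s in Ioo a b, ENNReal.ofReal ((b - s) ^ (c - 1)) = ENNReal.ofReal ((b - a) ^ c / c) := by
  have h := lintegral_Ioo_sub_left_rpow (a := 0) (b := b - a) (sub_pos.2 hab) hc
  rw [sub_zero, ← lintegral_indicator measurableSet_Ioo, ← lintegral_sub_left_eq_self _ b] at h
  rw [← h, ← lintegral_indicator measurableSet_Ioo]
  refine lintegral_congr fun s => ?_
  have : s ∈ Ioo a b ↔ b - s ∈ Ioo 0 (b - a) := by simp [and_comm]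
  simp only [indicator, this, sub_zero]

lemma lintegral_Iic_sub_rpow {a b e : ℝ} (hab : a < b) (he : 0 < e) :
    ∫⁻ s in Iic a, ENNReal.ofReal ((b - s) ^ (-e - 1)) = ENNReal.ofReal ((b - a) ^ (-e) / e) := by
  have h1 : ∫⁻ s in Ioi (b - a), ENNReal.ofReal (s ^ (-e - 1)) =
      ENNReal.ofReal ((b - a) ^ (-e) / e) := by
    rw [← ofReal_integral_eq_lintegral_ofReal
      (integrableOn_Ioi_rpow_of_lt (by linarith) (by linarith)),
      integral_Ioi_rpow_of_lt (by linarith) (by linarith), sub_add_cancel, neg_div_neg_eq]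
    filter_upwards [ae_restrict_mem measurableSet_Ioi] with y hy
    exact Real.rpow_nonneg (by linarith [mem_Ioi.1 hy]) _
  rw [← lintegral_indicator measurableSet_Ioi, ← lintegral_sub_left_eq_self _ b] at h1
  rw [← h1, ← restrict_Iio_eq_restrict_Iic, ← lintegral_indicator measurableSet_Iio]
  refine lintegral_congr fun s => ?_
  have : s ∈ Iio a ↔ b - s ∈ Ioi (b - a) := by simp
  simp only [indicator, this]

lemma rpow_le_two_rpow_mul_rpow {x y : ℝ} (e : ℝ) (hx : 0 < x) (h1 : x / 2 ≤ y) (h2 : y ≤ 2 * x) :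
    y ^ e ≤ 2 ^ |e| * x ^ e := by
  have hy : 0 < y := by linarith
  rcases le_total 0 e with he | he
  · rw [abs_of_nonneg he, ← Real.mul_rpow zero_le_two hx.le]
    exact Real.rpow_le_rpow hy.le h2 he
  · rw [abs_of_nonpos he]
    calc y ^ e ≤ (x / 2) ^ e := Real.rpow_le_rpow_of_nonpos (by positivity) h1 he
      _ = 2 ^ (-e) * x ^ e := by
        rw [Real.div_rpow hx.le zero_le_two, Real.rpow_neg zero_le_two, div_eq_inv_mul]

lemma one_le_two_rpow_mul_rpow_neg {e δ : ℝ} (he : 0 ≤ e) (h0 : 0 < δ) (h2 : δ ≤ 2) :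
    1 ≤ 2 ^ e * δ ^ (-e) := by
  rw [Real.rpow_neg h0.le, ← div_eq_mul_inv, ← Real.div_rpow zero_le_two h0.le]
  exact Real.one_le_rpow ((one_le_div h0).2 h2) he

/-- The interval runs from the midpoint of (-1, t) to t, so the singularity at -1 plays no role, and
only the competition between t - s and 1 - s has to be resolved. -/
lemma exists_lintegral_near_endpoint_le {α d : ℝ} (hα : 0 < α) (hd : α < d) :
    ∃ C : ℝ, 0 ≤ C ∧ ∀ t ∈ Ioo (-1 : ℝ) 1,
      ∫⁻ s in Ioo ((t - 1) / 2) t, ENNReal.ofReal ((t - s) ^ (α - 1) * (1 - s) ^ (-d)) ≤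
        ENNReal.ofReal (C * ((1 + t) ^ α * (1 - t) ^ (α - d))) := by
  have hda : 0 < d - α := sub_pos.2 hd
  refine ⟨2 ^ (d - α) / α + (1 / α + 1 / (d - α)), by positivity, fun t ht => ?_⟩
  have ht1 : 0 < 1 + t := by linarith [ht.1]
  have ht2 : 0 < 1 - t := by linarith [ht.2]
  have hmid : (t - 1) / 2 < t := by linarith
  -- For t ≤ 0 the factor (1 - s)^{-d} is at most 1, and 1 - t lies between 1 and 2.
  rcases le_or_gt t 0 with h0 | h0
  · calc ∫⁻ s in Ioo ((t - 1) / 2) t, ENNReal.ofReal ((t - s) ^ (α - 1) * (1 - s) ^ (-d))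
        ≤ ∫⁻ s in Ioo ((t - 1) / 2) t, ENNReal.ofReal ((t - s) ^ (α - 1)) := by
          refine setLIntegral_mono' measurableSet_Ioo fun s hs => ENNReal.ofReal_le_ofReal ?_
          refine mul_le_of_le_one_right (Real.rpow_nonneg (by linarith [hs.2]) _) ?_
          exact Real.rpow_le_one_of_one_le_of_nonpos (by linarith [hs.2]) (by linarith)
      _ = ENNReal.ofReal ((t - (t - 1) / 2) ^ α / α) := lintegral_Ioo_sub_right_rpow hmid hα
      _ ≤ _ := by
          refine ENNReal.ofReal_le_ofReal ?_
          have h1 : (t - (t - 1) / 2) ^ α ≤ (1 + t) ^ α :=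
            Real.rpow_le_rpow (by linarith) (by linarith) hα.le
          have h2 := one_le_two_rpow_mul_rpow_neg hda.le ht2 (by linarith [ht.1])
          rw [neg_sub] at h2
          calc (t - (t - 1) / 2) ^ α / α ≤ (1 + t) ^ α / α * (2 ^ (d - α) * (1 - t) ^ (α - d)) := by
                rw [← mul_one (_ / α)]
                gcongr
            _ = 2 ^ (d - α) / α * ((1 + t) ^ α * (1 - t) ^ (α - d)) := by ring
            _ ≤ _ := by
                gcongr
                have : 0 ≤ 1 / α + 1 / (d - α) := by positivity
                linarith
  -- For t > 0 the cut is at distance 1 - t below t. Beyond it 1 - s ≥ t - s, and d > α makes the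
  -- tail of (t - s)^{α-d-1} converge; within it 1 - s ≥ 1 - t. Both pieces have size (1 - t)^{α-d}.
  · have hlt : t - (1 - t) < t := by linarith
    calc ∫⁻ s in Ioo ((t - 1) / 2) t, ENNReal.ofReal ((t - s) ^ (α - 1) * (1 - s) ^ (-d))
        ≤ ∫⁻ s in Iic (t - (1 - t)) ∪ Ioo (t - (1 - t)) t,
            ENNReal.ofReal ((t - s) ^ (α - 1) * (1 - s) ^ (-d)) := by
          refine lintegral_mono_set fun s hs => ?_
          rcases le_or_gt s (t - (1 - t)) with h | h
          · exact Or.inl h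
          · exact Or.inr ⟨h, hs.2⟩
      _ ≤ (∫⁻ s in Iic (t - (1 - t)), ENNReal.ofReal ((t - s) ^ (α - 1) * (1 - s) ^ (-d))) +
          ∫⁻ s in Ioo (t - (1 - t)) t, ENNReal.ofReal ((t - s) ^ (α - 1) * (1 - s) ^ (-d)) :=
          lintegral_union_le _ _ _
      _ ≤ (∫⁻ s in Iic (t - (1 - t)), ENNReal.ofReal ((t - s) ^ (-(d - α) - 1))) +
          ∫⁻ s in Ioo (t - (1 - t)) t,
            ENNReal.ofReal ((1 - t) ^ (-d)) * ENNReal.ofReal ((t - s) ^ (α - 1)) := by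
          refine add_le_add ?_ ?_
          · refine setLIntegral_mono' measurableSet_Iic fun s hs => ENNReal.ofReal_le_ofReal ?_
            have hts : 0 < t - s := by linarith [mem_Iic.1 hs]
            rw [show -(d - α) - 1 = (α - 1) + -d by ring, Real.rpow_add hts]
            refine mul_le_mul_of_nonneg_left ?_ (by positivity)
            exact Real.rpow_le_rpow_of_nonpos hts (by linarith) (by linarith)
          · refine setLIntegral_mono' measurableSet_Ioo fun s hs => ?_
            have hts : 0 < t - s := by linarith [hs.2]
            rw [← ENNReal.ofReal_mul (by positivity), mul_comm]
            refine ENNReal.ofReal_le_ofReal (mul_le_mul_of_nonneg_right ?_ (by positivity))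
            exact Real.rpow_le_rpow_of_nonpos ht2 (by linarith) (by linarith)
      _ = ENNReal.ofReal ((1 / α + 1 / (d - α)) * (1 - t) ^ (α - d)) := by
          rw [lintegral_const_mul _ (by fun_prop), lintegral_Iic_sub_rpow hlt hda,
            lintegral_Ioo_sub_right_rpow hlt hα, ← ENNReal.ofReal_mul (by positivity),
            sub_sub_cancel, ← ENNReal.ofReal_add (by positivity) (by positivity), neg_sub,
            mul_div_assoc', ← Real.rpow_add ht2, show -d + α = α - d by ring]
          congr 1; ring
      _ ≤ _ := by
          refine ENNReal.ofReal_le_ofReal ?_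
          have h1 : 1 ≤ (1 + t) ^ α := Real.one_le_rpow (by linarith) hα.le
          have h2 : (1 - t) ^ (α - d) ≤ (1 + t) ^ α * (1 - t) ^ (α - d) :=
            le_mul_of_one_le_left (by positivity) h1
          refine mul_le_mul ?_ h2 (by positivity) (by positivity)
          have : 0 ≤ (2 : ℝ) ^ (d - α) / α := by positivity
          linarith

/-- A weighted estimate for the Riemann–Liouville integral on `(-1, 1)`. -/
lemma exists_lintegral_riemannLiouville_le {α c d : ℝ} (hα : 0 < α) (hc : 0 < c) (hd : α < d) :
    ∃ C : ℝ, 0 ≤ C ∧ ∀ t ∈ Ioo (-1 : ℝ) 1,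
      ∫⁻ s in Ioo (-1) t, ENNReal.ofReal ((t - s) ^ (α - 1) * (1 + s) ^ (c - 1) * (1 - s) ^ (-d)) ≤
        ENNReal.ofReal (C * ((1 + t) ^ (α + c - 1) * (1 - t) ^ (α - d))) := by
  have hda : 0 < d - α := sub_pos.2 hd
  obtain ⟨C, hC0, hC⟩ := exists_lintegral_near_endpoint_le hα hd
  refine ⟨2 ^ |α - 1| * 2 ^ (d - α) / c + 2 ^ |c - 1| * C, by positivity, fun t ht => ?_⟩
  have ht1 : 0 < 1 + t := by linarith [ht.1]
  have ht2 : 0 < 1 - t := by linarith [ht.2]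
  have hone := one_le_two_rpow_mul_rpow_neg hda.le ht2 (by linarith [ht.1])
  rw [neg_sub] at hone
  -- The cut is at the midpoint of (-1, t). To its left t - s is comparable to 1 + t, and c > 0
  -- gives integrability at -1; to its right 1 + s is comparable to 1 + t.
  calc _ ≤ ∫⁻ s in Ioc (-1) ((t - 1) / 2) ∪ Ioo ((t - 1) / 2) t,
        ENNReal.ofReal ((t - s) ^ (α - 1) * (1 + s) ^ (c - 1) * (1 - s) ^ (-d)) := by
        refine lintegral_mono_set fun s hs => ?_
        rcases le_or_gt s ((t - 1) / 2) with h | h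
        · exact Or.inl ⟨hs.1, h⟩
        · exact Or.inr ⟨h, hs.2⟩
    _ ≤ (∫⁻ s in Ioc (-1) ((t - 1) / 2),
          ENNReal.ofReal ((t - s) ^ (α - 1) * (1 + s) ^ (c - 1) * (1 - s) ^ (-d))) +
        ∫⁻ s in Ioo ((t - 1) / 2) t,
          ENNReal.ofReal ((t - s) ^ (α - 1) * (1 + s) ^ (c - 1) * (1 - s) ^ (-d)) :=
        lintegral_union_le _ _ _
    _ ≤ (∫⁻ s in Ioc (-1) ((t - 1) / 2), ENNReal.ofReal (2 ^ |α - 1| * (1 + t) ^ (α - 1)) *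
          ENNReal.ofReal ((s - -1) ^ (c - 1))) +
        ∫⁻ s in Ioo ((t - 1) / 2) t, ENNReal.ofReal (2 ^ |c - 1| * (1 + t) ^ (c - 1)) *
          ENNReal.ofReal ((t - s) ^ (α - 1) * (1 - s) ^ (-d)) := by
        refine add_le_add ?_ ?_
        · refine setLIntegral_mono' measurableSet_Ioc fun s hs => ?_
          have hs0 : 0 < 1 + s := by linarith [hs.1]
          rw [← ENNReal.ofReal_mul (by positivity)]
          refine ENNReal.ofReal_le_ofReal ?_
          have h1 := rpow_le_two_rpow_mul_rpow (x := 1 + t) (y := t - s) (α - 1) ht1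
            (by linarith [hs.2]) (by linarith [hs.1])
          have h2 : (1 - s) ^ (-d) ≤ 1 :=
            Real.rpow_le_one_of_one_le_of_nonpos (by linarith [hs.2, ht.2]) (by linarith)
          rw [sub_neg_eq_add, add_comm s 1]
          calc _ ≤ (t - s) ^ (α - 1) * (1 + s) ^ (c - 1) :=
                mul_le_of_le_one_right (mul_nonneg (Real.rpow_nonneg (by linarith [hs.2]) _)
                  (by positivity)) h2
            _ ≤ _ := mul_le_mul_of_nonneg_right h1 (by positivity)
        · refine setLIntegral_mono' measurableSet_Ioo fun s hs => ?_
          have hs0 : 0 < 1 - s := by linarith [hs.2, ht.2]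
          have hts : 0 < t - s := by linarith [hs.2]
          rw [← ENNReal.ofReal_mul (by positivity)]
          refine ENNReal.ofReal_le_ofReal ?_
          have h1 := rpow_le_two_rpow_mul_rpow (x := 1 + t) (y := 1 + s) (c - 1) ht1
            (by linarith [hs.1]) (by linarith [hs.2])
          rw [mul_right_comm, mul_comm (2 ^ |c - 1| * (1 + t) ^ (c - 1))]
          exact mul_le_mul_of_nonneg_left h1 (by positivity)
    _ ≤ ENNReal.ofReal (2 ^ |α - 1| * (1 + t) ^ (α - 1)) *
          ENNReal.ofReal ((1 + t) ^ c / c) +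
        ENNReal.ofReal (2 ^ |c - 1| * (1 + t) ^ (c - 1)) *
          ENNReal.ofReal (C * ((1 + t) ^ α * (1 - t) ^ (α - d))) := by
        rw [lintegral_const_mul _ (by fun_prop), lintegral_const_mul _ (by fun_prop),
          ← restrict_Ioo_eq_restrict_Ioc, lintegral_Ioo_sub_left_rpow (by linarith) hc]
        refine add_le_add (mul_le_mul' le_rfl (ENNReal.ofReal_le_ofReal ?_))
          (mul_le_mul' le_rfl (hC t ht))
        gcongr
        · linarith
        · linarith
    _ ≤ _ := by
        rw [← ENNReal.ofReal_mul (by positivity), ← ENNReal.ofReal_mul (by positivity),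
          ← ENNReal.ofReal_add (by positivity) (by positivity)]
        refine ENNReal.ofReal_le_ofReal ?_
        have e1 : (1 + t) ^ (α + c - 1) = (1 + t) ^ (α - 1) * (1 + t) ^ c := by
          rw [← Real.rpow_add ht1]; ring_nf
        have e2 : (1 + t) ^ (α + c - 1) = (1 + t) ^ (c - 1) * (1 + t) ^ α := by
          rw [← Real.rpow_add ht1]; ring_nf
        rw [add_mul]
        refine add_le_add ?_ (le_of_eq ?_)
        · rw [e1]
          calc _ = 2 ^ |α - 1| / c * ((1 + t) ^ (α - 1) * (1 + t) ^ c) * 1 := by ring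
            _ ≤ 2 ^ |α - 1| / c * ((1 + t) ^ (α - 1) * (1 + t) ^ c) *
                (2 ^ (d - α) * (1 - t) ^ (α - d)) :=
                mul_le_mul_of_nonneg_left hone (by positivity)
            _ = _ := by ring
        · rw [e2]; ring

/-! ### Schur's test. -/

/-- The Schur test for a nonnegative kernel, with power weights `U`. -/
lemma lintegral_rpow_lintegral_mul_le_of_schur {X : Type*} [MeasurableSpace X] {m : Measure X}
    [SFinite m] {p q : ℝ} (hpq : p.HolderConjugate q) {k : X → X → ℝ≥0∞}
    (hk : Measurable (Function.uncurry k)) {U f : X → ℝ≥0∞} (hU : Measurable U) (hf : Measurable f)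
    (hU0 : ∀ᵐ x ∂m, U x ≠ 0 ∧ U x ≠ ∞) {C : ℝ≥0∞}
    (h1 : ∀ᵐ x ∂m, ∫⁻ y, k x y * U y ^ q ∂m ≤ C * U x ^ q)
    (h2 : ∀ᵐ y ∂m, ∫⁻ x, k x y * U x ^ p ∂m ≤ C * U y ^ p) :
    ∫⁻ x, (∫⁻ y, k x y * f y ∂m) ^ p ∂m ≤ C ^ p * ∫⁻ x, f x ^ p ∂m := by
  have hp := hpq.pos
  have hq := hpq.symm.pos
  have hkx : ∀ x, Measurable (k x) := fun x => hk.comp measurable_prodMk_left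
  have hky : ∀ y, Measurable fun x => k x y := fun y => hk.comp measurable_prodMk_right
  have hsum : 1 / q + 1 / p = 1 := by
    have := hpq.inv_add_inv_eq_one
    rw [one_div, one_div]; linarith
  have step : ∀ᵐ x ∂m, (∫⁻ y, k x y * f y ∂m) ^ p ≤
      C ^ (p / q) * ∫⁻ y, U x ^ p * (k x y * ((U y)⁻¹ ^ p * f y ^ p)) ∂m := by
    filter_upwards [h1] with x hx
    -- Hölder's inequality is applied to k f = (k^{1/q} U)(k^{1/p} U⁻¹ f); the first factor is
    -- controlled by `h1`, and the second by `h2` after exchanging the integrals.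
    have heq : ∫⁻ y, k x y * f y ∂m =
        ∫⁻ y, (k x y ^ (1 / q) * U y) * (k x y ^ (1 / p) * ((U y)⁻¹ * f y)) ∂m := by
      refine lintegral_congr_ae ?_
      filter_upwards [hU0] with y hy
      have e1 : k x y = k x y ^ (1 / q) * k x y ^ (1 / p) := by
        rw [← ENNReal.rpow_add_of_nonneg _ _ (by positivity) (by positivity), hsum,
          ENNReal.rpow_one]
      calc k x y * f y = k x y ^ (1 / q) * k x y ^ (1 / p) * (U y * (U y)⁻¹) * f y := by
            rw [← e1, ENNReal.mul_inv_cancel hy.1 hy.2, mul_one]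
        _ = _ := by ring
    have hold := ENNReal.lintegral_mul_le_Lp_mul_Lq m hpq.symm
      (f := fun y => k x y ^ (1 / q) * U y) (g := fun y => k x y ^ (1 / p) * ((U y)⁻¹ * f y))
      (by have := hkx x; fun_prop) (by have := hkx x; fun_prop)
    rw [heq]
    have e2 : ∀ y, (k x y ^ (1 / q) * U y) ^ q = k x y * U y ^ q := fun y => by
      rw [ENNReal.mul_rpow_of_nonneg _ _ hq.le, ← ENNReal.rpow_mul, one_div_mul_cancel hq.ne',
        ENNReal.rpow_one]
    have e3 : ∀ y, (k x y ^ (1 / p) * ((U y)⁻¹ * f y)) ^ p =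
        k x y * ((U y)⁻¹ ^ p * f y ^ p) := fun y => by
      rw [ENNReal.mul_rpow_of_nonneg _ _ hp.le, ← ENNReal.rpow_mul, one_div_mul_cancel hp.ne',
        ENNReal.rpow_one, ENNReal.mul_rpow_of_nonneg _ _ hp.le]
    simp only [Pi.mul_apply, e2, e3] at hold
    calc _ ≤ ((∫⁻ y, k x y * U y ^ q ∂m) ^ (1 / q) *
          (∫⁻ y, k x y * ((U y)⁻¹ ^ p * f y ^ p) ∂m) ^ (1 / p)) ^ p :=
          ENNReal.rpow_le_rpow hold hp.le
      _ ≤ ((C * U x ^ q) ^ (1 / q) *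
          (∫⁻ y, k x y * ((U y)⁻¹ ^ p * f y ^ p) ∂m) ^ (1 / p)) ^ p := by
          gcongr
      _ = _ := by
          rw [ENNReal.mul_rpow_of_nonneg _ _ hp.le, ← ENNReal.rpow_mul, ← ENNReal.rpow_mul,
            one_div_mul_cancel hp.ne', ENNReal.rpow_one, ENNReal.mul_rpow_of_nonneg _ _
            (by positivity), ← ENNReal.rpow_mul, mul_assoc,
            lintegral_const_mul _ (by have := hkx x; fun_prop)]
          congr 2
          · ring_nf
          · congr 1
            field_simp
  calc _ ≤ ∫⁻ x, C ^ (p / q) * ∫⁻ y, U x ^ p * (k x y * ((U y)⁻¹ ^ p * f y ^ p)) ∂m ∂m :=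
        lintegral_mono_ae step
    _ = C ^ (p / q) * ∫⁻ x, ∫⁻ y, U x ^ p * (k x y * ((U y)⁻¹ ^ p * f y ^ p)) ∂m ∂m := by
        refine lintegral_const_mul _ (Measurable.lintegral_prod_right' (f := fun z : X × X =>
          U z.1 ^ p * (Function.uncurry k z * ((U z.2)⁻¹ ^ p * f z.2 ^ p))) (by fun_prop))
    _ = C ^ (p / q) * ∫⁻ y, ∫⁻ x, U x ^ p * (k x y * ((U y)⁻¹ ^ p * f y ^ p)) ∂m ∂m := by
        rw [lintegral_lintegral_swap]
        exact (show Measurable fun z : X × X =>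
          U z.1 ^ p * (Function.uncurry k z * ((U z.2)⁻¹ ^ p * f z.2 ^ p)) by fun_prop).aemeasurable
    _ ≤ C ^ (p / q) * ∫⁻ y, C * f y ^ p ∂m := by
        refine mul_le_mul' le_rfl (lintegral_mono_ae ?_)
        filter_upwards [h2, hU0] with y hy hy0
        calc _ = ((U y)⁻¹ ^ p * f y ^ p) * ∫⁻ x, k x y * U x ^ p ∂m := by
              rw [← lintegral_const_mul _ (by have := hky y; fun_prop)]
              exact lintegral_congr fun x => by ring
          _ ≤ ((U y)⁻¹ ^ p * f y ^ p) * (C * U y ^ p) := by gcongr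
          _ = ((U y)⁻¹ * U y) ^ p * (C * f y ^ p) := by
              rw [ENNReal.mul_rpow_of_nonneg _ _ hp.le]; ring
          _ = C * f y ^ p := by
              rw [ENNReal.inv_mul_cancel hy0.1 hy0.2, ENNReal.one_rpow, one_mul]
    _ = _ := by
        rw [lintegral_const_mul _ (by fun_prop), ← mul_assoc]
        congr 1
        -- The two tests contribute C^{p/q} and C, and p/q + 1 = p.
        nth_rewrite 2 [← ENNReal.rpow_one C]
        rw [← ENNReal.rpow_add_of_nonneg _ _ (by positivity) zero_le_one]
        congr 1
        have := hpq.sub_one_mul_conj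
        field_simp
        linarith

/-! ### Measurability, the equatorial reflection and the algebra of weights. -/

@[fun_prop]
lemma measurable_lastCoord {n : ℕ} : Measurable (lastCoord : Sph n → ℝ) := by
  unfold lastCoord; fun_prop

@[fun_prop]
lemma measurable_weight {n : ℕ} (μ ν : ℝ) : Measurable (weight n μ ν) := by
  unfold weight; fun_prop

lemma measurable_leftKernel {n : ℕ} (α : ℝ) :
    Measurable (Function.uncurry (leftKernel (n := n) α)) := by
  unfold leftKernel Function.uncurry
  refine Measurable.ite (measurableSet_lt (by fun_prop) (by fun_prop)) (by fun_prop)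
    measurable_const

/-- The reflection of the sphere in the equator. -/
noncomputable def equatorReflection (n : ℕ) : Sph n → Sph n :=
  sphMap (Submodule.reflection (ℝ ∙ (EuclideanSpace.single (Fin.last n) (1 : ℝ)))ᗮ)

lemma measurePreserving_equatorReflection (n : ℕ) :
    MeasurePreserving (equatorReflection n) (surf n) (surf n) :=
  measurePreserving_sphMap _

@[simp]
lemma equatorReflection_equatorReflection {n : ℕ} (x : Sph n) :
    equatorReflection n (equatorReflection n x) = x := by
  ext1
  simp [equatorReflection, sphMap]

@[simp]
lemma lastCoord_equatorReflection {n : ℕ} (x : Sph n) :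
    lastCoord (equatorReflection n x) = -lastCoord x := by
  set e := EuclideanSpace.single (Fin.last n) (1 : ℝ)
  have h : ∀ v : EuclideanSpace ℝ (Fin (n + 1)), v (Fin.last n) = inner ℝ e v := fun v => by
    simp [e, EuclideanSpace.inner_single_left]
  have hR : Submodule.reflection (ℝ ∙ e)ᗮ e = -e :=
    Submodule.reflection_orthogonalComplement_singleton_eq_neg e
  have h2 := LinearIsometryEquiv.inner_map_map (Submodule.reflection (ℝ ∙ e)ᗮ) e
    (x : EuclideanSpace ℝ (Fin (n + 1)))
  rw [hR, inner_neg_left] at h2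
  simp only [lastCoord, h]
  rw [← h2, neg_neg]
  rfl

lemma norm_equatorReflection_sub {n : ℕ} (x y : Sph n) :
    ‖(equatorReflection n x : EuclideanSpace ℝ (Fin (n + 1))) - equatorReflection n y‖ =
      ‖(x : EuclideanSpace ℝ (Fin (n + 1))) - y‖ := by
  simp only [equatorReflection, sphMap]
  rw [← map_sub, LinearIsometryEquiv.norm_map]

lemma weight_equatorReflection {n : ℕ} (μ ν : ℝ) (x : Sph n) :
    weight n μ ν (equatorReflection n x) = weight n ν μ x := by
  simp only [weight, lastCoord_equatorReflection, sub_neg_eq_add, ← sub_eq_add_neg, mul_comm]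

/-- The reflection reverses the order of the heights and keeps distances, so it transposes the
kernel. -/
lemma leftKernel_equatorReflection {n : ℕ} (α : ℝ) (x y : Sph n) :
    leftKernel α (equatorReflection n x) (equatorReflection n y) = leftKernel α y x := by
  simp only [leftKernel, lastCoord_equatorReflection, neg_lt_neg_iff, norm_equatorReflection_sub]
  rw [norm_sub_rev]
  ring_nf

lemma weight_pos {n : ℕ} {x : Sph n} (hx : lastCoord x ∈ Ioo (-1) 1) (μ ν : ℝ) :
    0 < weight n μ ν x :=
  mul_pos (Real.rpow_pos_of_pos (by linarith [hx.1]) _)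
    (Real.rpow_pos_of_pos (by linarith [hx.2]) _)

lemma ofReal_weight_mul {n : ℕ} {x : Sph n} (hx : lastCoord x ∈ Ioo (-1) 1) (μ ν μ' ν' : ℝ) :
    ENNReal.ofReal (weight n μ ν x) * ENNReal.ofReal (weight n μ' ν' x) =
      ENNReal.ofReal (weight n (μ + μ') (ν + ν') x) := by
  rw [← ENNReal.ofReal_mul (weight_pos hx _ _).le]
  simp only [weight]
  rw [Real.rpow_add (by linarith [hx.1]), Real.rpow_add (by linarith [hx.2])]
  ring_nf

lemma ofReal_weight_rpow {n : ℕ} {x : Sph n} (hx : lastCoord x ∈ Ioo (-1) 1) (μ ν e : ℝ) :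
    ENNReal.ofReal (weight n μ ν x) ^ e = ENNReal.ofReal (weight n (μ * e) (ν * e) x) := by
  have h1 : 0 ≤ 1 + lastCoord x := by linarith [hx.1]
  have h2 : 0 ≤ 1 - lastCoord x := by linarith [hx.2]
  rw [ENNReal.ofReal_rpow_of_pos (weight_pos hx _ _)]
  simp only [weight]
  rw [Real.mul_rpow (by positivity) (by positivity), Real.rpow_mul h1, Real.rpow_mul h2]

/-! ### The kernel acting on power weights. -/

lemma exists_lintegral_leftKernel_mul_weight_le (k : ℕ) {α a b : ℝ} (hα : 0 < α)
    (ha : -(((k : ℝ) + 2) / 2) < a) (hb : b < -α) :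
    ∃ C : ℝ≥0, ∀ x : Sph (k + 2), lastCoord x ∈ Ioo (-1) 1 →
      ∫⁻ y, leftKernel α x y * ENNReal.ofReal (weight _ a b y) ∂(surf (k + 2)) ≤
      C * ENNReal.ofReal (weight _ (a + α) (b + α) x) := by
  obtain ⟨C, hC⟩ := exists_lintegral_leftKernel_mul_le k α
  -- The reduced kernel contributes (1 + s)^{k/2}, so c - 1 = a + k/2. The conditions c > 0 and d >
  -- α are then a > -n/2 and b < -α.
  obtain ⟨D, hD0, hD⟩ := exists_lintegral_riemannLiouville_le (c := a + ((k : ℝ) + 2) / 2)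
    (d := -b) hα (by linarith) (by linarith)
  simp only [neg_neg, sub_neg_eq_add] at hD
  refine ⟨C * D.toNNReal, fun x hx => ?_⟩
  have h1 : 0 < 1 + lastCoord x := by linarith [hx.1]
  have h2 : 0 < 1 - lastCoord x := by linarith [hx.2]
  refine (hC (fun s => ENNReal.ofReal ((1 + s) ^ a * (1 - s) ^ b))
    (by fun_prop) x hx).trans ?_
  rw [ENNReal.coe_mul, mul_assoc]
  refine mul_le_mul' le_rfl ?_
  set t := lastCoord x with ht
  calc _ = ∫⁻ s in Ioo (-1) t, ENNReal.ofReal ((1 + t) ^ (-(k : ℝ) / 2)) *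
        ENNReal.ofReal ((t - s) ^ (α - 1) * (1 + s) ^ (a + ((k : ℝ) + 2) / 2 - 1) * (1 - s) ^ b) := by
        refine setLIntegral_congr_fun measurableSet_Ioo fun s hs => ?_
        have h3 : 0 < 1 + s := by linarith [hs.1]
        have h4 : 0 < t - s := by linarith [hs.2]
        rw [← ENNReal.ofReal_mul (by positivity), ← ENNReal.ofReal_mul (by positivity)]
        congr 1
        rw [show a + ((k : ℝ) + 2) / 2 - 1 = (k : ℝ) / 2 + a by ring, Real.rpow_add h3]
        ring
    _ = ENNReal.ofReal ((1 + t) ^ (-(k : ℝ) / 2)) * ∫⁻ s in Ioo (-1) t,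
        ENNReal.ofReal ((t - s) ^ (α - 1) * (1 + s) ^ (a + ((k : ℝ) + 2) / 2 - 1) * (1 - s) ^ b) :=
        lintegral_const_mul _ (by fun_prop)
    _ ≤ ENNReal.ofReal ((1 + t) ^ (-(k : ℝ) / 2)) *
        ENNReal.ofReal (D * ((1 + t) ^ (α + (a + ((k : ℝ) + 2) / 2) - 1) *
          (1 - t) ^ (α + b))) :=
        mul_le_mul' le_rfl (hD t hx)
    _ = _ := by
        rw [← ENNReal.ofReal, ← ENNReal.ofReal_mul (by positivity), ← ENNReal.ofReal_mul hD0]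
        congr 1
        simp only [weight, ← ht]
        rw [show a + α = -(k : ℝ) / 2 + (α + (a + ((k : ℝ) + 2) / 2) - 1) by ring,
          Real.rpow_add h1, add_comm b α]
        ring

/-- Integration in the first variable is integration in the second after reflection in the equator,
which also exchanges the two exponents of the weight. -/
lemma exists_lintegral_leftKernel_mul_weight_le' (k : ℕ) {α a b : ℝ} (hα : 0 < α)
    (ha : a < -α) (hb : -(((k : ℝ) + 2) / 2) < b) :
    ∃ C : ℝ≥0, ∀ y : Sph (k + 2), lastCoord y ∈ Ioo (-1) 1 →
      ∫⁻ x, leftKernel α x y * ENNReal.ofReal (weight _ a b x) ∂(surf (k + 2)) ≤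
      C * ENNReal.ofReal (weight _ (a + α) (b + α) y) := by
  obtain ⟨C, hC⟩ := exists_lintegral_leftKernel_mul_weight_le k hα hb ha
  refine ⟨C, fun y hy => ?_⟩
  have h := hC (equatorReflection _ y) (by
    rw [lastCoord_equatorReflection]; exact ⟨by linarith [hy.2], by linarith [hy.1]⟩)
  rw [weight_equatorReflection, ← (measurePreserving_equatorReflection _).lintegral_comp] at h
  · simpa only [leftKernel_equatorReflection, weight_equatorReflection] using h
  · exact ((measurable_leftKernel α).comp measurable_prodMk_left).mul (by fun_prop)

/-- The weighted bound for the positive operator with kernel `leftKernel`. -/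
lemma exists_eLpNorm_lintegral_leftKernel_le (k : ℕ) {p p' : ℝ≥0∞}
    (hp : ENNReal.HolderConjugate p p') {α μ ν : ℝ} (hα : 0 < α)
    (hμ : μ < ((k : ℝ) + 2) / 2 * (1 / p').toReal)
    (hν : -(((k : ℝ) + 2) / 2 * (1 / p).toReal) < ν - α) :
    ∃ C : ℝ≥0, ∀ f : Sph (k + 2) → ℝ≥0∞, Measurable f →
      eLpNorm (fun x => ENNReal.ofReal (weight _ (μ - α) (ν - α) x) *
        ∫⁻ y, leftKernel α x y * f y ∂(surf (k + 2))) p (surf (k + 2)) ≤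
      C * eLpNorm (fun x => ENNReal.ofReal (weight _ μ ν x) * f x) p (surf (k + 2)) := by
  have hae : ∀ᵐ x ∂(surf (k + 2)), lastCoord x ∈ Ioo (-1) 1 := ae_lastCoord_mem (k + 1)
  have hK := measurable_leftKernel (n := k + 2) α
  have hKx : ∀ x : Sph (k + 2), Measurable (leftKernel α x) :=
    fun x => hK.comp measurable_prodMk_left
  have hKy : ∀ y : Sph (k + 2), Measurable fun x => leftKernel α x y :=
    fun y => hK.comp measurable_prodMk_right
  -- For p = ∞, f is dominated by its norm times the reciprocal weight, so it suffices to apply the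
  -- kernel to that weight.
  rcases eq_or_ne p ∞ with rfl | hptop
  · have hp1 : p' = 1 := by
      have := hp.inv_add_inv_eq_one
      simpa using this
    subst hp1
    simp only [div_one, ENNReal.toReal_one, mul_one, one_div, ENNReal.inv_top, ENNReal.toReal_zero,
      mul_zero, neg_zero] at hμ hν
    obtain ⟨C, hC⟩ := exists_lintegral_leftKernel_mul_weight_le k (α := α)
      (a := -μ) (b := -ν) hα (by linarith) (by linarith)
    refine ⟨C, fun f hf => ?_⟩
    rw [eLpNorm_exponent_top, eLpNorm_exponent_top]
    set M := eLpNormEssSup (fun x => ENNReal.ofReal (weight _ μ ν x) * f x) (surf (k + 2)) with hM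
    have hMle : ∀ᵐ y ∂(surf (k + 2)), f y ≤ M * ENNReal.ofReal (weight _ (-μ) (-ν) y) := by
      filter_upwards [hae, enorm_ae_le_eLpNormEssSup (fun x => ENNReal.ofReal (weight _ μ ν x) * f x)
        (surf (k + 2))] with y hy hle
      rw [enorm_eq_self] at hle
      calc f y = ENNReal.ofReal (weight _ μ ν y) * f y * ENNReal.ofReal (weight _ (-μ) (-ν) y) := by
            rw [mul_right_comm, ofReal_weight_mul hy]
            simp [weight]
        _ ≤ _ := mul_le_mul' hle le_rfl
    refine essSup_le_of_ae_le _ ?_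
    filter_upwards [hae] with x hx
    rw [enorm_eq_self]
    calc _ ≤ ENNReal.ofReal (weight _ (μ - α) (ν - α) x) *
          ∫⁻ y, M * (leftKernel α x y * ENNReal.ofReal (weight _ (-μ) (-ν) y)) ∂(surf (k + 2)) := by
          refine mul_le_mul' le_rfl (lintegral_mono_ae ?_)
          filter_upwards [hMle] with y hy
          rw [mul_left_comm]
          exact mul_le_mul' le_rfl hy
      _ ≤ ENNReal.ofReal (weight _ (μ - α) (ν - α) x) * (M *
          (C * ENNReal.ofReal (weight _ (-μ + α) (-ν + α) x))) := by
          rw [lintegral_const_mul _ (by have := hKx x; fun_prop)]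
          exact mul_le_mul' le_rfl (mul_le_mul' le_rfl (hC x hx))
      _ = C * M * (ENNReal.ofReal (weight _ (μ - α) (ν - α) x) *
          ENNReal.ofReal (weight _ (-μ + α) (-ν + α) x)) := by ring
      _ = C * M := by
          rw [ofReal_weight_mul hx]
          simp [weight]
  -- For p = 1, Tonelli's theorem moves the kernel onto the target weight, and only the transposed
  -- estimate is needed.
  rcases eq_or_ne p 1 with rfl | hpone
  · have hp1 : p' = ∞ := by
      have := hp.inv_add_inv_eq_one
      simpa using this
    subst hp1
    simp only [div_one, ENNReal.toReal_one, mul_one, one_div, ENNReal.inv_top, ENNReal.toReal_zero,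
      mul_zero] at hμ hν
    obtain ⟨C, hC⟩ := exists_lintegral_leftKernel_mul_weight_le' k (α := α)
      (a := μ - α) (b := ν - α) hα (by linarith) (by linarith)
    refine ⟨C, fun f hf => ?_⟩
    simp only [eLpNorm_one_eq_lintegral_enorm, enorm_eq_self]
    calc _ = ∫⁻ x, ∫⁻ y, ENNReal.ofReal (weight _ (μ - α) (ν - α) x) *
          (leftKernel α x y * f y) ∂(surf (k + 2)) ∂(surf (k + 2)) := by
          refine lintegral_congr fun x => ?_
          rw [lintegral_const_mul _ (by have := hKx x; fun_prop)]
      _ = ∫⁻ y, ∫⁻ x, ENNReal.ofReal (weight _ (μ - α) (ν - α) x) *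
          (leftKernel α x y * f y) ∂(surf (k + 2)) ∂(surf (k + 2)) := by
          rw [lintegral_lintegral_swap]
          exact (show Measurable fun z : Sph (k + 2) × Sph (k + 2) =>
            ENNReal.ofReal (weight _ (μ - α) (ν - α) z.1) *
              (Function.uncurry (leftKernel α) z * f z.2) by fun_prop).aemeasurable
      _ ≤ ∫⁻ y, C * (ENNReal.ofReal (weight _ μ ν y) * f y) ∂(surf (k + 2)) := by
          refine lintegral_mono_ae ?_
          filter_upwards [hae] with y hy
          calc _ = f y * ∫⁻ x, leftKernel α x y * ENNReal.ofReal (weight _ (μ - α) (ν - α) x)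
                ∂(surf (k + 2)) := by
                rw [← lintegral_const_mul _ (by have := hKy y; fun_prop)]
                exact lintegral_congr fun x => by ring
            _ ≤ f y * (C * ENNReal.ofReal (weight _ μ ν y)) := by
                have := hC y hy
                rw [sub_add_cancel, sub_add_cancel] at this
                exact mul_le_mul' le_rfl this
            _ = _ := by ring
      _ = _ := lintegral_const_mul _ (by fun_prop)
  have hp0 : p ≠ 0 := hp.ne_zero
  have hr : p.toReal.HolderConjugate p'.toReal := by
    refine ENNReal.HolderConjugate.toReal_of_ne_top hptop ?_
    rintro rfl
    exact hpone (by simpa using hp.inv_add_inv_eq_one)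
  set r := p.toReal with hrdef
  set q := p'.toReal with hqdef
  have hr0 := hr.pos
  have hq0 := hr.symm.pos
  have hpr : (1 / p).toReal = 1 / r := by simp [hrdef]
  have hpq : (1 / p').toReal = 1 / q := by simp [hqdef]
  rw [hpr] at hν
  rw [hpq] at hμ
  have hsum : 1 / r + 1 / q = 1 := by
    rw [one_div, one_div]; exact hr.inv_add_inv_eq_one
  set h := ((k : ℝ) + 2) / 2 with hh
  -- The test weight is U with exponents (-a, -b). The bounds on a and b are the conditions of the
  -- two weight estimates for the conjugated kernel; since 1/r + 1/q = 1, the intervals are nonempty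
  -- by `hμ` and `hν` respectively.
  obtain ⟨a, ha1, ha2⟩ : ∃ a, μ * (1 / r) < a ∧ a < (h - μ) * (1 / q) := by
    have : μ * (1 / r) + μ * (1 / q) = μ := by rw [← mul_add, hsum, mul_one]
    exact exists_between (by linarith)
  obtain ⟨b, hb1, hb2⟩ : ∃ b, (α - ν) * (1 / q) < b ∧ b < (h + ν - α) * (1 / r) := by
    have : (α - ν) * (1 / r) + (α - ν) * (1 / q) = α - ν := by rw [← mul_add, hsum, mul_one]
    exact exists_between (by linarith)
  rw [mul_one_div, div_lt_iff₀ hr0] at ha1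
  rw [mul_one_div, lt_div_iff₀ hq0] at ha2
  rw [mul_one_div, div_lt_iff₀ hq0] at hb1
  rw [mul_one_div, lt_div_iff₀ hr0] at hb2
  obtain ⟨C₁, hC₁⟩ := exists_lintegral_leftKernel_mul_weight_le k (α := α)
    (a := -μ + -a * q) (b := -ν + -b * q) hα (by linarith) (by linarith)
  obtain ⟨C₂, hC₂⟩ := exists_lintegral_leftKernel_mul_weight_le' k (α := α)
    (a := μ - α + -a * r) (b := ν - α + -b * r) hα (by linarith) (by linarith)
  -- The Schur test takes one constant for both conditions; the sum dominates each.
  refine ⟨C₁ + C₂, fun f hf => ?_⟩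
  have hpt := lintegral_rpow_lintegral_mul_le_of_schur (m := surf (k + 2)) hr
    (k := fun x y => ENNReal.ofReal (weight _ (μ - α) (ν - α) x) * leftKernel α x y *
      ENNReal.ofReal (weight _ (-μ) (-ν) y))
    (U := fun x => ENNReal.ofReal (weight _ (-a) (-b) x))
    (f := fun x => ENNReal.ofReal (weight _ μ ν x) * f x) (C := (C₁ + C₂ : ℝ≥0))
    (show Measurable fun z : Sph (k + 2) × Sph (k + 2) =>
      ENNReal.ofReal (weight _ (μ - α) (ν - α) z.1) * Function.uncurry (leftKernel α) z *
        ENNReal.ofReal (weight _ (-μ) (-ν) z.2) by fun_prop) (by fun_prop) (by fun_prop) ?_ ?_ ?_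
  · rw [eLpNorm_eq_lintegral_rpow_enorm_toReal hp0 hptop,
      eLpNorm_eq_lintegral_rpow_enorm_toReal hp0 hptop]
    simp only [enorm_eq_self, ← hrdef]
    calc _ = (∫⁻ x, (∫⁻ y, ENNReal.ofReal (weight _ (μ - α) (ν - α) x) * leftKernel α x y *
          ENNReal.ofReal (weight _ (-μ) (-ν) y) * (ENNReal.ofReal (weight _ μ ν y) * f y)
            ∂(surf (k + 2))) ^ r ∂(surf (k + 2))) ^ (1 / r) := by
          congr 1
          refine lintegral_congr fun x => ?_
          congr 1
          rw [← lintegral_const_mul _ (by have := hKx x; fun_prop)]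
          refine lintegral_congr_ae ?_
          filter_upwards [hae] with y hy
          have := ofReal_weight_mul hy (-μ) (-ν) μ ν
          rw [neg_add_cancel, neg_add_cancel] at this
          calc _ = ENNReal.ofReal (weight _ (μ - α) (ν - α) x) * leftKernel α x y *
                (1 * f y) := by ring
            _ = _ := by
              rw [show (1 : ℝ≥0∞) = ENNReal.ofReal (weight (k + 2) 0 0 y) by simp [weight], ← this]
              ring
      _ ≤ (((C₁ + C₂ : ℝ≥0) : ℝ≥0∞) ^ r * ∫⁻ x, (ENNReal.ofReal (weight _ μ ν x) * f x) ^ r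
          ∂(surf (k + 2))) ^ (1 / r) := ENNReal.rpow_le_rpow hpt (by positivity)
      _ = _ := by
          rw [ENNReal.mul_rpow_of_nonneg _ _ (by positivity), ← ENNReal.rpow_mul,
            mul_one_div_cancel hr0.ne', ENNReal.rpow_one]
  · filter_upwards [hae] with x hx
    exact ⟨by simpa using weight_pos hx _ _, ENNReal.ofReal_ne_top⟩
  · filter_upwards [hae] with x hx
    rw [ofReal_weight_rpow hx]
    calc _ = ENNReal.ofReal (weight _ (μ - α) (ν - α) x) * ∫⁻ y, leftKernel α x y *
          ENNReal.ofReal (weight _ (-μ + -a * q) (-ν + -b * q) y) ∂(surf (k + 2)) := by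
          rw [← lintegral_const_mul _ (by have := hKx x; fun_prop)]
          refine lintegral_congr_ae ?_
          filter_upwards [hae] with y hy
          rw [ofReal_weight_rpow hy, ← ofReal_weight_mul hy]
          ring
      _ ≤ ENNReal.ofReal (weight _ (μ - α) (ν - α) x) * (C₁ *
          ENNReal.ofReal (weight _ (-μ + -a * q + α) (-ν + -b * q + α) x)) :=
          mul_le_mul' le_rfl (hC₁ x hx)
      _ = C₁ * ENNReal.ofReal (weight _ (-a * q) (-b * q) x) := by
          rw [mul_left_comm, ofReal_weight_mul hx]
          ring_nf
      _ ≤ _ := by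
          gcongr
          exact le_self_add
  · filter_upwards [hae] with y hy
    rw [ofReal_weight_rpow hy]
    calc _ = ENNReal.ofReal (weight _ (-μ) (-ν) y) * ∫⁻ x, leftKernel α x y *
          ENNReal.ofReal (weight _ (μ - α + -a * r) (ν - α + -b * r) x) ∂(surf (k + 2)) := by
          rw [← lintegral_const_mul _ (by have := hKy y; fun_prop)]
          refine lintegral_congr_ae ?_
          filter_upwards [hae] with x hx
          rw [ofReal_weight_rpow hx, ← ofReal_weight_mul hx]
          ring
      _ ≤ ENNReal.ofReal (weight _ (-μ) (-ν) y) * (C₂ *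
          ENNReal.ofReal (weight _ (μ - α + -a * r + α) (ν - α + -b * r + α) y)) :=
          mul_le_mul' le_rfl (hC₂ y hy)
      _ = C₂ * ENNReal.ofReal (weight _ (-a * r) (-b * r) y) := by
          rw [mul_left_comm, ofReal_weight_mul hy]
          ring_nf
      _ ≤ _ := by
          gcongr
          exact le_add_self

/-! ### From the positive kernel operator to the left-sided integral. -/

lemma ae_lt_top_of_eLpNorm_lt_top {X : Type*} [MeasurableSpace X] {m : Measure X} {p : ℝ≥0∞}
    (hp : p ≠ 0) {f : X → ℝ≥0∞} (hf : Measurable f) (h : eLpNorm f p m < ∞) :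
    ∀ᵐ x ∂m, f x < ∞ := by
  rcases eq_or_ne p ∞ with rfl | hptop
  · rw [eLpNorm_exponent_top] at h
    filter_upwards [enorm_ae_le_eLpNormEssSup f m] with x hx
    exact lt_of_le_of_lt hx h
  · have h1 := lintegral_rpow_enorm_lt_top_of_eLpNorm_lt_top hp hptop h
    filter_upwards [ae_lt_top (by simp only [enorm_eq_self]; fun_prop) h1.ne] with x hx
    exact (ENNReal.rpow_lt_top_iff_of_pos (ENNReal.toReal_pos hp hptop)).1 hx

lemma measurableSet_segment {n : ℕ} (a b : ℝ) : MeasurableSet (segment n a b) :=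
  (measurableSet_lt measurable_const measurable_lastCoord).inter
    (measurableSet_lt measurable_lastCoord measurable_const)

/-- Membership in the weighted space only gives measurability of the product; the weight can be
divided out because it vanishes at most at the poles. -/
lemma aestronglyMeasurable_of_weight_mul (k : ℕ) {μ ν : ℝ} {φ : Sph (k + 1) → ℂ}
    (h : AEStronglyMeasurable (fun x => (weight _ μ ν x : ℂ) * φ x) (surf (k + 1))) :
    AEStronglyMeasurable φ (surf (k + 1)) := by
  have hm : AEStronglyMeasurable (fun x => ((weight (k + 1) μ ν x : ℂ))⁻¹ *
      ((weight (k + 1) μ ν x : ℂ) * φ x)) (surf (k + 1)) :=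
    AEStronglyMeasurable.mul (Measurable.aestronglyMeasurable (by fun_prop)) h
  refine hm.congr ?_
  filter_upwards [ae_lastCoord_mem k] with x hx
  rw [inv_mul_cancel_left₀]
  exact_mod_cast (weight_pos hx μ ν).ne'

lemma setLIntegral_enorm_leftIntegrand (k : ℕ) (α : ℝ) {φ ψ : Sph (k + 1) → ℂ}
    (h : φ =ᵐ[surf (k + 1)] ψ) (x : Sph (k + 1)) :
    ∫⁻ y in segment _ (-1) (lastCoord x), ‖leftIntegrand α φ x y‖ₑ ∂(surf (k + 1)) =
      ∫⁻ y, leftKernel α x y * ‖ψ y‖ₑ ∂(surf (k + 1)) := by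
  rw [← lintegral_indicator (measurableSet_segment _ _)]
  refine lintegral_congr_ae ?_
  filter_upwards [h, ae_lastCoord_mem k] with y hy hy1
  simp only [indicator, leftKernel, segment, mem_ofPred_eq, hy1.1, true_and]
  split_ifs with hlt
  · rw [leftIntegrand, enorm_mul, hy]
    congr 1
    rw [← ofReal_norm, Complex.norm_real, Real.norm_of_nonneg]
    exact div_nonneg (Real.rpow_nonneg (by linarith) _) (by positivity)
  · simp

/-- Replacing φ by a measurable representative changes no value of the integral, and then the
integrand is jointly measurable. -/
lemma aestronglyMeasurable_SPlus (k : ℕ) (α : ℝ) {φ : Sph (k + 1) → ℂ}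
    (hφ : AEStronglyMeasurable φ (surf (k + 1))) :
    AEStronglyMeasurable (SPlus α φ) (surf (k + 1)) := by
  have heq : SPlus α φ = fun x => ((2 / (Real.Gamma α * sphereArea (k + 1)) : ℝ) : ℂ) *
      ∫ y, {z : Sph (k + 1) × Sph (k + 1) |
        -1 < lastCoord z.2 ∧ lastCoord z.2 < lastCoord z.1}.indicator
        (fun z => leftIntegrand α (hφ.mk φ) z.1 z.2) (x, y) ∂(surf (k + 1)) := by
    funext x
    rw [SPlus, leftFrac, ← integral_indicator (measurableSet_segment _ _)]
    congr 1
    refine integral_congr_ae ?_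
    filter_upwards [hφ.ae_eq_mk] with y hy
    simp only [indicator, segment, mem_ofPred_eq, leftIntegrand, hy]
    congr
  rw [heq]
  refine AEStronglyMeasurable.const_mul (StronglyMeasurable.aestronglyMeasurable ?_) _
  have hs : MeasurableSet {z : Sph (k + 1) × Sph (k + 1) |
      -1 < lastCoord z.2 ∧ lastCoord z.2 < lastCoord z.1} := by
    rw [ofPred_and]
    exact (measurableSet_lt (by fun_prop) (by fun_prop)).inter
      (measurableSet_lt (by fun_prop) (by fun_prop))
  refine StronglyMeasurable.integral_prod_right' (StronglyMeasurable.indicator ?_ hs)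
  have hψ : Measurable (hφ.mk φ) := hφ.stronglyMeasurable_mk.measurable
  refine Measurable.stronglyMeasurable ?_
  unfold leftIntegrand
  fun_prop

/-- The positive operator applied to |φ| dominates the fractional integral. Its weighted norm is
finite, so it is finite almost everywhere, which is absolute convergence. -/
lemma isBoundedOp_SPlus (k : ℕ) {p p' : ℝ≥0∞} (hp : ENNReal.HolderConjugate p p') {α μ ν : ℝ}
    (hα : 0 < α) (hμ : μ < ((k : ℝ) + 2) / 2 * (1 / p').toReal)
    (hν : -(((k : ℝ) + 2) / 2 * (1 / p).toReal) < ν - α) :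
    IsBoundedOp (SPlus α) (LeftFracExists α (-1)) p (weight (k + 2) μ ν)
      (weight (k + 2) (μ - α) (ν - α)) := by
  obtain ⟨C, hC⟩ := exists_eLpNorm_lintegral_leftKernel_le k hp hα hμ hν
  set c : ℝ := 2 / (Real.Gamma α * sphereArea (k + 2)) with hc
  refine ⟨‖(c : ℂ)‖₊ * C, fun φ hφ => ?_⟩
  have hae : ∀ᵐ x ∂(surf (k + 2)), lastCoord x ∈ Ioo (-1) 1 := ae_lastCoord_mem (k + 1)
  have hφm : AEStronglyMeasurable φ (surf (k + 2)) :=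
    aestronglyMeasurable_of_weight_mul (k + 1) hφ.1
  set ψ := hφm.mk φ with hψdef
  have hφψ : φ =ᵐ[surf (k + 2)] ψ := hφm.ae_eq_mk
  have hψ : Measurable fun y => ‖ψ y‖ₑ := hφm.stronglyMeasurable_mk.enorm
  have hF := setLIntegral_enorm_leftIntegrand (k + 1) α hφψ
  set F : Sph (k + 2) → ℝ≥0∞ := fun x => ∫⁻ y, leftKernel α x y * ‖ψ y‖ₑ ∂(surf (k + 2)) with hFdef
  have hFm : Measurable F := Measurable.lintegral_prod_right'
    (f := fun z : Sph (k + 2) × Sph (k + 2) => Function.uncurry (leftKernel α) z * ‖ψ z.2‖ₑ)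
    ((measurable_leftKernel α).mul (hψ.comp measurable_snd))
  have hbound : eLpNorm (fun x => ENNReal.ofReal (weight _ (μ - α) (ν - α) x) * F x) p
      (surf (k + 2)) ≤ C * wNorm p (weight _ μ ν) φ := by
    refine (hC _ hψ).trans_eq ?_
    congr 1
    refine eLpNorm_congr_enorm_ae ?_
    filter_upwards [hae, hφψ] with x hx hx'
    rw [enorm_eq_self, enorm_mul, hx', ← ofReal_norm (weight _ μ ν x : ℂ), Complex.norm_real,
      Real.norm_of_nonneg (weight_pos hx _ _).le]
  have hfin : ∀ᵐ x ∂(surf (k + 2)), F x < ∞ := by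
    have hlt := hbound.trans_lt (ENNReal.mul_lt_top ENNReal.coe_lt_top hφ.2)
    filter_upwards [hae, ae_lt_top_of_eLpNorm_lt_top hp.ne_zero (by fun_prop) hlt] with x hx hx'
    refine (ENNReal.lt_top_of_mul_ne_top_right hx'.ne ?_)
    simpa using weight_pos hx _ _
  have hle : wNorm p (weight _ (μ - α) (ν - α)) (SPlus α φ) ≤
      (‖(c : ℂ)‖₊ * C : ℝ≥0) * wNorm p (weight _ μ ν) φ := by
    rw [ENNReal.coe_mul, mul_assoc]
    refine le_trans (eLpNorm_le_mul_eLpNorm_of_ae_le_mul' (c := ‖(c : ℂ)‖₊)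
      (g := fun x => ENNReal.ofReal (weight _ (μ - α) (ν - α) x) * F x) ?_ p)
      (mul_le_mul' le_rfl hbound)
    filter_upwards [hae] with x hx
    rw [enorm_eq_self, enorm_mul, ← ofReal_norm (weight _ _ _ x : ℂ), Complex.norm_real,
      Real.norm_of_nonneg (weight_pos hx _ _).le, mul_left_comm]
    refine mul_le_mul' le_rfl ?_
    rw [SPlus, leftFrac, enorm_mul]
    exact mul_le_mul' le_rfl ((enorm_integral_le_lintegral_enorm _).trans_eq (hF x))
  refine ⟨?_, ⟨?_, hle.trans_lt (ENNReal.mul_lt_top ENNReal.coe_lt_top hφ.2)⟩, hle⟩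
  · filter_upwards [hfin] with x hx
    refine ⟨?_, ?_⟩
    · refine AEStronglyMeasurable.restrict ?_
      exact AEStronglyMeasurable.mul (Measurable.aestronglyMeasurable (by fun_prop)) hφm
    · rw [hasFiniteIntegral_iff_enorm, hF x]
      exact hx
  · exact AEStronglyMeasurable.mul (Measurable.aestronglyMeasurable (by fun_prop))
      (aestronglyMeasurable_SPlus (k + 1) α hφm)

/-- As 1 - x_{n+1} ≤ 2, lowering ν enlarges the weight up to the factor 2^{ν' - ν}, so the domain
shrinks. -/
lemma IsBoundedOp.weight_mono {k : ℕ} {T : (Sph (k + 1) → ℂ) → Sph (k + 1) → ℂ}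
    {E : (Sph (k + 1) → ℂ) → Sph (k + 1) → Prop} {p : ℝ≥0∞} {μ ν ν' : ℝ} {v : Sph (k + 1) → ℝ}
    (hν : ν ≤ ν') (h : IsBoundedOp T E p (weight _ μ ν') v) :
    IsBoundedOp T E p (weight _ μ ν) v := by
  obtain ⟨C, hC⟩ := h
  set D : ℝ≥0 := (2 ^ (ν' - ν) : ℝ).toNNReal with hD
  refine ⟨C * D, fun φ hφ => ?_⟩
  have hle : ∀ᵐ x ∂(surf (k + 1)), ‖(weight _ μ ν' x : ℂ) * φ x‖ₑ ≤
      D * ‖(weight _ μ ν x : ℂ) * φ x‖ₑ := by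
    filter_upwards [ae_lastCoord_mem k] with x hx
    rw [enorm_mul, enorm_mul, ← mul_assoc]
    refine mul_le_mul' ?_ le_rfl
    rw [← ofReal_norm, ← ofReal_norm, Complex.norm_real, Complex.norm_real,
      Real.norm_of_nonneg (weight_pos hx _ _).le, Real.norm_of_nonneg (weight_pos hx _ _).le,
      hD, ← ENNReal.ofReal, ← ENNReal.ofReal_mul (by positivity)]
    refine ENNReal.ofReal_le_ofReal ?_
    have h1 : 0 < 1 + lastCoord x := by linarith [hx.1]
    have h2 : 0 < 1 - lastCoord x := by linarith [hx.2]
    simp only [weight]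
    rw [mul_left_comm]
    refine mul_le_mul_of_nonneg_left ?_ (by positivity)
    calc (1 - lastCoord x) ^ ν' = (1 - lastCoord x) ^ (ν' - ν) * (1 - lastCoord x) ^ ν := by
          rw [← Real.rpow_add h2, sub_add_cancel]
      _ ≤ _ := by
          refine mul_le_mul_of_nonneg_right ?_ (by positivity)
          exact Real.rpow_le_rpow h2.le (by linarith [hx.1]) (by linarith)
  have hm : MemWLp p (weight _ μ ν') φ := by
    refine MemLp.of_enorm_le_mul hφ ?_ hle
    exact AEStronglyMeasurable.mul (Measurable.aestronglyMeasurable (by fun_prop))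
      (aestronglyMeasurable_of_weight_mul k hφ.1)
  obtain ⟨h1, h2, h3⟩ := hC φ hm
  refine ⟨h1, h2, h3.trans ?_⟩
  rw [ENNReal.coe_mul, mul_assoc]
  exact mul_le_mul' le_rfl (eLpNorm_le_mul_eLpNorm_of_ae_le_mul' hle p)

lemma isBoundedOp_SPlus_shiftedExp {n : ℕ} (hn : 2 ≤ n) {p p' : ℝ≥0∞}
    (hp : ENNReal.HolderConjugate p p') {α μ ε : ℝ} (ν : ℝ) (hα : 0 < α) (hε : 0 < ε)
    (hμ : μ < (n : ℝ) / 2 * (1 / p').toReal) :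
    IsBoundedOp (SPlus α) (LeftFracExists α (-1)) p (weight n μ ν)
      (weight n (μ - α) (shiftedExp n p α ν ε)) := by
  obtain ⟨k, rfl⟩ : ∃ k, n = k + 2 := ⟨n - 2, by omega⟩
  have hk : ((k + 2 : ℕ) : ℝ) = (k : ℝ) + 2 := by push_cast; ring
  rw [hk] at hμ
  rw [shiftedExp, hk]
  split_ifs with h
  · exact isBoundedOp_SPlus k hp hα hμ h
  -- This ν' is chosen so that ν' - α is the prescribed target exponent. It exceeds -n/(2p) because
  -- ε > 0, and ν ≤ ν' because ν - α ≤ -n/(2p).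
  · set ν' := -(((k : ℝ) + 2) / 2 * (1 / p).toReal) + ε + α with hν'
    have := isBoundedOp_SPlus k hp (ν := ν') hα hμ (by linarith)
    rw [show ν' - α = -(((k : ℝ) + 2) / 2 * (1 / p).toReal) + ε by ring] at this
    exact IsBoundedOp.weight_mono (k := k + 1) (by linarith) this

/-! ### The right-sided integral by reflection. -/

/-- The reflection in the equator as a measurable equivalence. -/
noncomputable def equatorReflectionEquiv (n : ℕ) : Sph n ≃ᵐ Sph n :=
  MeasurableEquiv.ofInvolutive (equatorReflection n) equatorReflection_equatorReflection
    (measurePreserving_equatorReflection n).measurable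

lemma measurableEmbedding_equatorReflection (n : ℕ) :
    MeasurableEmbedding (equatorReflection n) :=
  (equatorReflectionEquiv n).measurableEmbedding

lemma segment_lastCoord_equatorReflection {n : ℕ} (x : Sph n) :
    segment n (-1) (lastCoord (equatorReflection n x)) =
      equatorReflection n ⁻¹' segment n (lastCoord x) 1 := by
  ext y
  simp only [segment, mem_ofPred_eq, mem_preimage, lastCoord_equatorReflection]
  constructor <;> rintro ⟨h1, h2⟩ <;> constructor <;> linarith

lemma leftIntegrand_comp_equatorReflection {n : ℕ} (α : ℝ) (φ : Sph n → ℂ) (x : Sph n) :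
    leftIntegrand α (φ ∘ equatorReflection n) (equatorReflection n x) =
      rightIntegrand α φ x ∘ equatorReflection n := by
  funext y
  have h := norm_equatorReflection_sub x (equatorReflection n y)
  rw [equatorReflection_equatorReflection] at h
  simp only [leftIntegrand, rightIntegrand, Function.comp_apply, lastCoord_equatorReflection, h]
  rw [show -lastCoord x - lastCoord y = -lastCoord y - lastCoord x by ring]

lemma rightFracExists_iff {n : ℕ} (α : ℝ) (φ : Sph n → ℂ) (x : Sph n) :
    RightFracExists α 1 φ x ↔
      LeftFracExists α (-1) (φ ∘ equatorReflection n) (equatorReflection n x) := by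
  rw [RightFracExists, LeftFracExists, segment_lastCoord_equatorReflection,
    leftIntegrand_comp_equatorReflection,
    (measurePreserving_equatorReflection n).integrableOn_comp_preimage
      (measurableEmbedding_equatorReflection n)]

lemma SMinus_eq {n : ℕ} (α : ℝ) (φ : Sph n → ℂ) :
    SMinus α φ = SPlus α (φ ∘ equatorReflection n) ∘ equatorReflection n := by
  funext x
  rw [SMinus, rightFrac, Function.comp_apply, SPlus, leftFrac, segment_lastCoord_equatorReflection,
    leftIntegrand_comp_equatorReflection]
  congr 1
  exact ((measurePreserving_equatorReflection n).setIntegral_preimage_emb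
    (measurableEmbedding_equatorReflection n) _ _).symm

lemma weight_mul_comp_equatorReflection {n : ℕ} (μ ν : ℝ) (φ : Sph n → ℂ) :
    (fun x => (weight n ν μ x : ℂ) * (φ ∘ equatorReflection n) x) =
      (fun x => (weight n μ ν x : ℂ) * φ x) ∘ equatorReflection n := by
  funext x
  simp [weight_equatorReflection]

lemma memWLp_comp_equatorReflection {n : ℕ} {p : ℝ≥0∞} {μ ν : ℝ} {φ : Sph n → ℂ}
    (h : MemWLp p (weight n μ ν) φ) :
    MemWLp p (weight n ν μ) (φ ∘ equatorReflection n) := by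
  rw [MemWLp, weight_mul_comp_equatorReflection]
  exact MemLp.comp_measurePreserving h (measurePreserving_equatorReflection n)

lemma wNorm_comp_equatorReflection {n : ℕ} {p : ℝ≥0∞} {μ ν : ℝ} {φ : Sph n → ℂ}
    (h : MemWLp p (weight n μ ν) φ) :
    wNorm p (weight n ν μ) (φ ∘ equatorReflection n) = wNorm p (weight n μ ν) φ := by
  rw [wNorm, weight_mul_comp_equatorReflection]
  exact eLpNorm_comp_measurePreserving h.1 (measurePreserving_equatorReflection n)

/-- The reflection conjugates the right-sided integral into the left-sided one and is an isometry
between the weighted spaces with the two exponents exchanged. -/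
lemma isBoundedOp_SMinus_of_SPlus {n : ℕ} {p : ℝ≥0∞} {α μ ν μ' ν' : ℝ}
    (h : IsBoundedOp (SPlus α) (LeftFracExists α (-1)) p (weight n ν μ) (weight n ν' μ')) :
    IsBoundedOp (SMinus α) (RightFracExists α 1) p (weight n μ ν) (weight n μ' ν') := by
  obtain ⟨C, hC⟩ := h
  refine ⟨C, fun φ hφ => ?_⟩
  obtain ⟨h1, h2, h3⟩ := hC _ (memWLp_comp_equatorReflection hφ)
  refine ⟨?_, ?_, ?_⟩
  · filter_upwards [(measurePreserving_equatorReflection n).quasiMeasurePreserving.ae h1] with x hx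
    exact (rightFracExists_iff α φ x).2 hx
  · rw [SMinus_eq]
    exact memWLp_comp_equatorReflection h2
  · rw [SMinus_eq, wNorm_comp_equatorReflection h2, ← wNorm_comp_equatorReflection hφ]
    exact h3

end SphericalFrac

theorem mainTheorem5 (n : ℕ) (hn : 2 ≤ n) (p p' : ENNReal) (hp : ENNReal.HolderConjugate p p')
    (α μ ν ε : ℝ) (hα : 0 < α) (hε : 0 < ε) :
    (μ < (n : ℝ) / 2 * (1 / p').toReal →
      SphericalFrac.IsBoundedOp (SphericalFrac.SPlus α) (SphericalFrac.LeftFracExists α (-1)) p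
        (SphericalFrac.weight n μ ν)
        (SphericalFrac.weight n (μ - α) (SphericalFrac.shiftedExp n p α ν ε))) ∧
    (ν < (n : ℝ) / 2 * (1 / p').toReal →
      SphericalFrac.IsBoundedOp (SphericalFrac.SMinus α) (SphericalFrac.RightFracExists α 1) p
        (SphericalFrac.weight n μ ν)
        (SphericalFrac.weight n (SphericalFrac.shiftedExp n p α μ ε) (ν - α))) :=
  ⟨fun hμ => SphericalFrac.isBoundedOp_SPlus_shiftedExp hn hp ν hα hε hμ,
    fun hν => SphericalFrac.isBoundedOp_SMinus_of_SPlus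
      (SphericalFrac.isBoundedOp_SPlus_shiftedExp hn hp μ hα hε hν)⟩
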